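/- Let $\sigma^2>0$, $p>2$ and $1<q<p$. Put $(\mathcal A W)(\varphi)=\int_{\varphi-1/2}^{\varphi+1/2}W(s)\,ds$ and $\Psi_r(w)=r\,\mathrm{sgn}(w)|w|^{r-1}$. For $K\in(0,\infty)$ let $I_K=(-K,K]$ and let $L^r(I_K)$ be the space of $2K$-periodic functions on $\mathbb R$ that are $r$-integrable over $I_K$; for $K=\infty$ let $I_\infty=\mathbb R$ and $L^r(I_\infty)=L^r(\mathbb R)$. For $K\in(0,\infty]$ define $X_K=\{W\in L^2(I_K):\mathcal A W\in L^q(I_K)\cap L^p(I_K)\}$, the action $$\mathcal L_K(W)=\tfrac12\sigma^2\|W\|_{2,I_K}^2+\int_{I_K}|\mathcal A W|^q\,d\varphi-\int_{I_K}|\mathcal A W|^p\,d\varphi ,$$ the Nehari manifold $$M_K=\Big\{W\in X_K: W\neq0,\ \sigma^2\|W\|_{2,I_K}^2+q\int_{I_K}|\mathcal A W|^q\,d\varphi-p\int_{I_K}|\mathcal A W|^p\,d\varphi=0\Big\},$$ and $\ell_K=\inf_{M_K}\mathcal L_K$. A ground wave in $X_K$ (periodic for $K<\infty$, solitary for $K=\infty$)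 is a solution $W\in X_K\setminus\{0\}$ of $\sigma^2W+\mathcal A\Psi_q(\mathcal A W)=\mathcal A\Psi_p(\mathcal A W)$ whose action $\mathcal L_K(W)$ is minimal among all solutions of this equation in $X_K\setminus\{0\}$. Then $\mathcal L_\infty$ attains its minimum on $M_\infty$, and $\ell_\infty=\lim_{K\to\infty}\ell_K$. Moreover, every unbounded sequence $(K_m)_{m\in\mathbb N}$ in $(0,\infty)$ has a subsequence $(K_n)$ with $K_n\to\infty$ for which there exist periodic ground waves $W_n\in M_{K_n}$ and a solitary ground wave $W_\infty\in M_\infty$ such that the functions $V_n$, defined by $V_n=W_n$ on $I_{K_n}$ and $V_n=0$ on $\mathbb R\setminus I_{K_n}$, belong to $X_\infty$ and satisfy $$\|W_\infty-V_n\|_{L^2(\mathbb R)}\to0\quad\text{as } n\to\infty .$$ -/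

import Mathlib

open MeasureTheory Filter Topology

namespace FPU

noncomputable section

/-- The cell `I_K = (-K, K]` for `0 < K < ∞`, and `I_∞ = ℝ`.
The parameter `K ∈ (0, ∞]` is an extended real. -/
def cell (K : EReal) : Set ℝ := {x : ℝ | -K < (x : EReal) ∧ (x : EReal) ≤ K}

theorem cell_coe (K : ℝ) : cell (K : EReal) = Set.Ioc (-K) K := by
  ext x
  simp only [cell, Set.mem_ofPred_eq, Set.mem_Ioc, ← EReal.coe_neg, EReal.coe_lt_coe_iff,
    EReal.coe_le_coe_iff]

theorem cell_top : cell ⊤ = Set.univ := by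
  ext x
  simp [cell]

/-- The convolution operator `(A W)(φ) = ∫_{φ-1/2}^{φ+1/2} W(s) ds`. -/
def A (W : ℝ → ℝ) (φ : ℝ) : ℝ := ∫ s in (φ - 1 / 2)..(φ + 1 / 2), W s

/-- `Ψ_r(w) = r sgn(w) |w|^{r-1}`, the derivative of `|w|^r`. -/
def Psi (r w : ℝ) : ℝ := r * SignType.sign w * |w| ^ (r - 1)

/-- Lebesgue functions on `I_K`: functions on `ℝ` that are `2K`-periodic if `K < ∞` and
`r`-integrable over the cell. Functions are identified when they agree almost everywhere. -/
def MemLpCell (K : EReal) (r : ℝ) (W : ℝ → ℝ) : Prop :=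
  (K ≠ ⊤ → Function.Periodic W (2 * K.toReal)) ∧
    MemLp W (ENNReal.ofReal r) (volume.restrict (cell K))

/-- The ansatz space `X_K` of all `W ∈ L²(I_K)` with `A W ∈ L^q(I_K) ∩ L^p(I_K)`. -/
def X (p q : ℝ) (K : EReal) : Set (ℝ → ℝ) :=
  {W | MemLpCell K 2 W ∧ MemLpCell K q (A W) ∧ MemLpCell K p (A W)}

/-- `‖W‖²` in `L²(I_K)`. -/
def normSq (K : EReal) (W : ℝ → ℝ) : ℝ := ∫ φ in cell K, W φ ^ 2

/-- `∫_{I_K} |A W|^r`; this is `Q_K` for `r = q` and `P_K` for `r = p`. -/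
def potential (r : ℝ) (K : EReal) (W : ℝ → ℝ) : ℝ := ∫ φ in cell K, |A W φ| ^ r

/-- The action `L_K(W) = ½ σ² ‖W‖² + Q_K(W) - P_K(W)`. -/
def action (σ p q : ℝ) (K : EReal) (W : ℝ → ℝ) : ℝ :=
  1 / 2 * σ ^ 2 * normSq K W + potential q K W - potential p K W

/-- The Nehari functional `F_K(W) = σ² ‖W‖² + q Q_K(W) - p P_K(W)`. -/
def nehariFunctional (σ p q : ℝ) (K : EReal) (W : ℝ → ℝ) : ℝ :=
  σ ^ 2 * normSq K W + q * potential q K W - p * potential p K W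

/-- The Nehari manifold `M_K`; `W ≠ 0` is meant in `L²`, that is, up to null sets. -/
def nehari (σ p q : ℝ) (K : EReal) : Set (ℝ → ℝ) :=
  {W | W ∈ X p q K ∧ ¬ W =ᵐ[volume] 0 ∧ nehariFunctional σ p q K W = 0}

/-- `ℓ_K = inf L_K|_{M_K}`. -/
def ell (σ p q : ℝ) (K : EReal) : ℝ := sInf (action σ p q K '' nehari σ p q K)

/-- The gradient `∂L_K(W) = σ² W + A Ψ_q(A W) - A Ψ_p(A W)`. -/
def gradAction (σ p q : ℝ) (W : ℝ → ℝ) (φ : ℝ) : ℝ :=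
  σ ^ 2 * W φ + A (fun s => Psi q (A W s)) φ - A (fun s => Psi p (A W s)) φ

/-- Nontrivial travelling waves in `X_K`: the solutions `W ≠ 0` of
`σ² W + A Ψ_q(A W) = A Ψ_p(A W)`, equivalently of `∂L_K(W) = 0`. -/
def travellingWaves (σ p q : ℝ) (K : EReal) : Set (ℝ → ℝ) :=
  {W | W ∈ X p q K ∧ ¬ W =ᵐ[volume] 0 ∧ gradAction σ p q W =ᵐ[volume] 0}

/-- A ground wave is a nontrivial travelling wave whose action is minimal among all
nontrivial travelling waves in `X_K`. -/
def IsGroundWave (σ p q : ℝ) (K : EReal) (W : ℝ → ℝ) : Prop :=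
  W ∈ travellingWaves σ p q K ∧ IsMinOn (action σ p q K) (travellingWaves σ p q K) W

end

end FPU

/-! Since `p` exceeds both `2` and `q`, the action along a ray `t ↦ t W` with `A W ≠ 0` has a single
critical point `t > 0`, a maximum, and there the ray meets the Nehari manifold. On the manifold the
`p`-potential can be eliminated, which leaves `c₁ ‖W‖² + c₂ ∫ |A W|^q` with `c₁, c₂ > 0`
(`action_eq_of_nehari`). This form is coercive and suited to Fatou's lemma.

Averaging turns an `L²` bound on `W` into sup and Hölder-1/2 bounds on `A W` that are uniform in `K
≥ 1`, so for bounded sequences `A W_n` converges pointwise along a subsequence. On a bounded cell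
the potentials then converge by domination, and a midpoint argument makes minimizing sequences
Cauchy in `L²` (`exists_periodic_minimizer`). Minimizers solve the travelling wave equation
(`gradAction_ae_eq_zero_of_isMinOn`), and every nontrivial travelling wave lies on the Nehari
manifold (`travellingWaves_subset_nehari`); hence minimizers are ground waves.

For `K → ∞`, an amplitude bound independent of `K` allows translating the periodic minimizers so
that `|A W_K 0| ≥ δ`. The equation expresses `W_K` through `A W_K`, so `W_K` itself converges almost
everywhere, to a solution `V` on the line that is nonzero because of `δ` (`exists_pointwise_limit`).
Solving the equation puts `V` on the manifold. Fatou bounds its action by `lim ℓ_K`, while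
truncating and periodizing functions on the line bounds `limsup ℓ_K` by `ℓ_∞` (`eventually_ell_lt`).
So `V` is a minimizer, Fatou loses nothing, the norms converge, and pointwise convergence becomes
strong convergence in `L²` (`tendsto_integral_sq_sub`). -/

namespace FPU

/-! ### Periodic functions and integrals over a cell -/

/-- The periodicity required of functions on the cell: `2K`-periodic if `K < ∞`, no condition
if `K = ∞`. -/
def PerOn (K : EReal) (f : ℝ → ℝ) : Prop := K ≠ ⊤ → Function.Periodic f (2 * K.toReal)

theorem eq_top_or_exists_coe {K : EReal} (hK : 1 ≤ K) : K = ⊤ ∨ ∃ k : ℝ, 1 ≤ k ∧ K = k := by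
  induction K with
  | bot => exact absurd (le_bot_iff.1 hK) (EReal.coe_ne_bot 1)
  | coe k => exact Or.inr ⟨k, by exact_mod_cast hK, rfl⟩
  | top => exact Or.inl rfl

theorem measurableSet_cell {K : EReal} (hK : 1 ≤ K) : MeasurableSet (cell K) := by
  obtain rfl | ⟨k, -, rfl⟩ := eq_top_or_exists_coe hK
  · simp [cell_top]
  · simp [cell_coe]

theorem perOn_top (f : ℝ → ℝ) : PerOn ⊤ f := fun h => absurd rfl h

theorem perOn_coe {k : ℝ} {f : ℝ → ℝ} : PerOn (k : EReal) f ↔ Function.Periodic f (2 * k) := by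
  simp [PerOn]

theorem perOn_const (K : EReal) (c : ℝ) : PerOn K (fun _ => c) := fun _ _ => rfl

theorem PerOn.comp {K : EReal} {f : ℝ → ℝ} (hf : PerOn K f) (g : ℝ → ℝ) :
    PerOn K (fun x => g (f x)) := fun h x => by simp only [hf h x]

theorem PerOn.comp₂ {K : EReal} {f g : ℝ → ℝ} (hf : PerOn K f) (hg : PerOn K g)
    (F : ℝ → ℝ → ℝ) : PerOn K (fun x => F (f x) (g x)) := fun h x => by
  simp only [hf h x, hg h x]

theorem PerOn.add_right {K : EReal} {f : ℝ → ℝ} (hf : PerOn K f) (s : ℝ) :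
    PerOn K (fun x => f (x + s)) := fun h x => by
  simp only [add_right_comm x _ s, hf h (x + s)]

theorem PerOn.A {K : EReal} {f : ℝ → ℝ} (hf : PerOn K f) : PerOn K (A f) := fun h x => by
  have h1 := intervalIntegral.integral_comp_add_right (a := x - 1 / 2) (b := x + 1 / 2) f
    (2 * K.toReal)
  simp only [hf h _] at h1
  rw [FPU.A, FPU.A, h1]
  congr 1 <;> ring

theorem PerOn.integrableOn_cell_add {K : EReal} (hK : 1 ≤ K) {f : ℝ → ℝ} (hf : PerOn K f)
    (hi : IntegrableOn f (cell K)) (s : ℝ) : IntegrableOn (fun x => f (x + s)) (cell K) := by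
  obtain rfl | ⟨k, hk, rfl⟩ := eq_top_or_exists_coe hK
  · rw [cell_top, integrableOn_univ] at *
    exact hi.comp_add_right s
  · rw [perOn_coe] at hf
    rw [cell_coe, ← intervalIntegrable_iff_integrableOn_Ioc_of_le (by linarith)] at *
    have h2 : (-k + 2 * k) = k := by ring
    have := hf.intervalIntegrable (t := -k) (by linarith) (by rwa [h2]) (-k + s) (k + s)
    simpa using this.comp_add_right s

theorem PerOn.integral_cell_add {K : EReal} (hK : 1 ≤ K) {f : ℝ → ℝ} (hf : PerOn K f) (s : ℝ) :
    ∫ x in cell K, f (x + s) = ∫ x in cell K, f x := by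
  obtain rfl | ⟨k, hk, rfl⟩ := eq_top_or_exists_coe hK
  · simp only [cell_top, Measure.restrict_univ]
    exact integral_add_right_eq_self f s
  · rw [perOn_coe] at hf
    rw [cell_coe, ← intervalIntegral.integral_of_le (by linarith),
      ← intervalIntegral.integral_of_le (by linarith),
      intervalIntegral.integral_comp_add_right (fun x => f x)]
    have := hf.intervalIntegral_add_eq (-k + s) (-k)
    convert this using 2 <;> ring

theorem PerOn.locallyIntegrable {K : EReal} (hK : 1 ≤ K) {f : ℝ → ℝ} (hf : PerOn K f)
    (hi : IntegrableOn f (cell K)) : LocallyIntegrable f volume := by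
  obtain rfl | ⟨k, hk, rfl⟩ := eq_top_or_exists_coe hK
  · rw [cell_top, integrableOn_univ] at *
    exact hi.locallyIntegrable
  · rw [perOn_coe] at hf
    rw [cell_coe, ← intervalIntegrable_iff_integrableOn_Ioc_of_le (by linarith)] at *
    have h2 : (-k + 2 * k) = k := by ring
    have h3 := hf.intervalIntegrable (t := -k) (by linarith) (by rwa [h2])
    intro x
    refine ⟨Set.Ioc (x - 1) (x + 1), Ioc_mem_nhds (by linarith) (by linarith), ?_⟩
    exact (intervalIntegrable_iff_integrableOn_Ioc_of_le (by linarith)).1 (h3 _ _)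

/-- As `K ≥ 1`, a window of length at most one fits into a single period. The constant is therefore
1 for every cell, which makes the later bounds on `A W` uniform in `K`. -/
theorem PerOn.integral_window_le {K : EReal} (hK : 1 ≤ K) {f : ℝ → ℝ} (hf : PerOn K f)
    (hi : IntegrableOn f (cell K)) (h0 : ∀ x, 0 ≤ f x) {a b : ℝ} (hab : a ≤ b)
    (hb : b ≤ a + 1) :
    ∫ s in a..b, f s ≤ ∫ x in cell K, f x := by
  have hl := hf.locallyIntegrable hK hi
  obtain rfl | ⟨k, hk, rfl⟩ := eq_top_or_exists_coe hK
  · rw [cell_top, integrableOn_univ] at *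
    rw [intervalIntegral.integral_of_le hab, Measure.restrict_univ]
    exact setIntegral_le_integral hi (Eventually.of_forall h0)
  · rw [perOn_coe] at hf
    rw [cell_coe, ← intervalIntegral.integral_of_le (by linarith)] at *
    have := hf.intervalIntegral_add_eq a (-k)
    have h2 : (-k + 2 * k) = k := by ring
    rw [h2] at this
    rw [← this]
    refine intervalIntegral.integral_mono_interval le_rfl hab (by linarith)
      (Eventually.of_forall h0) ?_
    exact (hl.integrableOn_isCompact isCompact_uIcc).intervalIntegrable

/-- The integral over every unit window is dominated by the cell integral, and countably many unit
windows cover the line. -/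
theorem PerOn.ae_eq_zero {K : EReal} (hK : 1 ≤ K) {f : ℝ → ℝ} (hf : PerOn K f)
    (hi : IntegrableOn f (cell K)) (h0 : ∀ x, 0 ≤ f x) (h : ∫ x in cell K, f x = 0) :
    f =ᵐ[volume] 0 := by
  have hl := hf.locallyIntegrable hK hi
  have key : ∀ n : ℤ, ∀ᵐ x ∂volume.restrict (Set.Ioc (n : ℝ) (n + 1)), f x = 0 := by
    intro n
    have h1 := hf.integral_window_le hK hi h0 (a := (n : ℝ)) (b := n + 1) (by linarith) le_rfl
    rw [h, intervalIntegral.integral_of_le (by linarith)] at h1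
    have h2 : ∫ x in Set.Ioc (n : ℝ) (n + 1), f x = 0 :=
      le_antisymm h1 (integral_nonneg h0)
    rw [integral_eq_zero_iff_of_nonneg h0
      ((hl.integrableOn_isCompact isCompact_Icc).mono_set Set.Ioc_subset_Icc_self)] at h2
    exact h2
  have := (ae_restrict_iUnion_iff (μ := volume) (fun n : ℤ => Set.Ioc (n : ℝ) (n + 1))
    (fun x => f x = 0)).2 key
  rw [iUnion_Ioc_intCast, Measure.restrict_univ] at this
  exact this

/-! ### The averaging operator -/

theorem LocallyIntegrable.intervalIntegrable {f : ℝ → ℝ} (hf : LocallyIntegrable f volume)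
    (a b : ℝ) : IntervalIntegrable f volume a b :=
  (hf.integrableOn_isCompact isCompact_uIcc).intervalIntegrable

theorem A_eq_integral_shift (f : ℝ → ℝ) (x : ℝ) :
    A f x = ∫ s in (-(1 / 2) : ℝ)..(1 / 2), f (x + s) := by
  rw [intervalIntegral.integral_comp_add_left (fun s => f s) x, A, sub_eq_add_neg]

theorem A_comp_add_right (f : ℝ → ℝ) (s x : ℝ) : A (fun y => f (y + s)) x = A f (x + s) := by
  simp only [A_eq_integral_shift, add_right_comm]

theorem A_congr_ae {f g : ℝ → ℝ} (h : f =ᵐ[volume] g) : A f = A g := by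
  ext x
  exact intervalIntegral.integral_congr_ae (h.mono fun y hy _ => hy)

theorem A_add {f g : ℝ → ℝ} (hf : LocallyIntegrable f volume) (hg : LocallyIntegrable g volume)
    (x : ℝ) : A (fun y => f y + g y) x = A f x + A g x :=
  intervalIntegral.integral_add (LocallyIntegrable.intervalIntegrable hf _ _)
    (LocallyIntegrable.intervalIntegrable hg _ _)

theorem A_const_mul (c : ℝ) (f : ℝ → ℝ) (x : ℝ) : A (fun y => c * f y) x = c * A f x :=
  intervalIntegral.integral_const_mul _ _

theorem A_const (c x : ℝ) : A (fun _ => c) x = c := by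
  simp only [A, intervalIntegral.integral_const, smul_eq_mul]; ring

theorem continuous_A {f : ℝ → ℝ} (hf : LocallyIntegrable f volume) : Continuous (A f) := by
  have h := intervalIntegral.continuous_primitive
    (fun a b => LocallyIntegrable.intervalIntegrable hf a b) 0
  have : A f = fun x => (∫ s in (0 : ℝ)..(x + 1 / 2), f s) - ∫ s in (0 : ℝ)..(x - 1 / 2), f s := by
    ext x
    rw [intervalIntegral.integral_interval_sub_left] <;>
    first | rfl | exact LocallyIntegrable.intervalIntegrable hf _ _
  rw [this]
  exact (h.comp (continuous_id.add continuous_const)).sub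
    (h.comp (continuous_id.sub continuous_const))

theorem abs_A_le_of_bound {f : ℝ → ℝ} {M : ℝ} (h : ∀ x, |f x| ≤ M) (x : ℝ) : |A f x| ≤ M := by
  have := intervalIntegral.norm_integral_le_of_norm_le_const (a := x - 1 / 2) (b := x + 1 / 2)
    (f := f) (C := M) (fun y _ => h y)
  simp only [add_sub_sub_cancel] at this
  norm_num at this
  exact this

theorem A_mono {f g : ℝ → ℝ} (hf : LocallyIntegrable f volume) (hg : LocallyIntegrable g volume)
    (h : ∀ x, f x ≤ g x) (x : ℝ) : A f x ≤ A g x :=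
  intervalIntegral.integral_mono_on (by linarith) (LocallyIntegrable.intervalIntegrable hf _ _)
    (LocallyIntegrable.intervalIntegrable hg _ _) fun y _ => h y

/-- Cauchy–Schwarz against the constant 1, in the form that the variance of `f` about its mean `c`
is nonnegative. -/
theorem sq_integral_le {f : ℝ → ℝ} (hf : LocallyIntegrable f volume)
    (hf2 : LocallyIntegrable (fun x => f x ^ 2) volume) {a b : ℝ} (hab : a ≤ b) :
    (∫ s in a..b, f s) ^ 2 ≤ (b - a) * ∫ s in a..b, f s ^ 2 := by
  obtain rfl | hlt := hab.eq_or_lt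
  · simp
  have i1 := LocallyIntegrable.intervalIntegrable hf a b
  have i2 := LocallyIntegrable.intervalIntegrable hf2 a b
  set c := (∫ s in a..b, f s) / (b - a) with hc
  have h0 : 0 ≤ ∫ s in a..b, (f s - c) ^ 2 :=
    intervalIntegral.integral_nonneg hab fun x _ => sq_nonneg _
  have h1 : ∫ s in a..b, (f s - c) ^ 2
      = (∫ s in a..b, f s ^ 2) - 2 * c * (∫ s in a..b, f s) + c ^ 2 * (b - a) := by
    have : ∀ s, (f s - c) ^ 2 = f s ^ 2 - 2 * c * f s + c ^ 2 := fun s => by ring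
    simp only [this]
    rw [intervalIntegral.integral_add (i2.sub (i1.const_mul _)) intervalIntegrable_const,
      intervalIntegral.integral_sub i2 (i1.const_mul _), intervalIntegral.integral_const_mul,
      intervalIntegral.integral_const, smul_eq_mul]
    ring
  have hpos : 0 < b - a := by linarith
  have h2 : (∫ s in a..b, f s) = c * (b - a) := by rw [hc]; field_simp
  rw [h1, h2] at h0
  rw [h2]
  nlinarith

/-- The shifted functions `x ↦ η (x + s)`, `|s| ≤ 1/2`, are jointly integrable. -/
theorem integrable_prod_shift {K : EReal} (hK : 1 ≤ K) {η : ℝ → ℝ} (hη : PerOn K η)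
    (hi : IntegrableOn η (cell K)) :
    Integrable (fun z : ℝ × ℝ => η (z.1 + z.2))
      ((volume.restrict (cell K)).prod (volume.restrict (Set.Ioc (-(1 / 2) : ℝ) (1 / 2)))) := by
  have hm : AEStronglyMeasurable η volume := (hη.locallyIntegrable hK hi).aestronglyMeasurable
  have hm2 : AEStronglyMeasurable (fun z : ℝ × ℝ => η (z.1 + z.2))
      ((volume.restrict (cell K)).prod (volume.restrict (Set.Ioc (-(1 / 2) : ℝ) (1 / 2)))) := by
    rw [Measure.prod_restrict]
    exact (hm.comp_quasiMeasurePreserving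
      (quasiMeasurePreserving_add volume volume)).restrict
  rw [integrable_prod_iff' hm2]
  refine ⟨Eventually.of_forall fun s => hη.integrableOn_cell_add hK hi s, ?_⟩
  have : ∀ s, ∫ x in cell K, ‖η (x + s)‖ = ∫ x in cell K, |η x| := fun s =>
    (hη.comp (fun y => |y|)).integral_cell_add hK s
  simp only [this]
  exact integrable_const _

theorem integrableOn_A {K : EReal} (hK : 1 ≤ K) {η : ℝ → ℝ} (hη : PerOn K η)
    (hi : IntegrableOn η (cell K)) : IntegrableOn (A η) (cell K) := by
  have := (integrable_prod_shift hK hη hi).integral_prod_left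
  refine this.congr (Eventually.of_forall fun x => ?_)
  simp only
  rw [A_eq_integral_shift, intervalIntegral.integral_of_le (by norm_num)]

/-- The averaging operator is symmetric. -/
theorem integral_mul_A {K : EReal} (hK : 1 ≤ K) {g η : ℝ → ℝ} (hg : PerOn K g)
    (hgc : Continuous g) {M : ℝ} (hM : ∀ x, |g x| ≤ M) (hη : PerOn K η)
    (hi : IntegrableOn η (cell K)) :
    ∫ x in cell K, g x * A η x = ∫ x in cell K, A g x * η x := by
  have e1 : ∀ x, g x * A η x = ∫ s in Set.Ioc (-(1 / 2) : ℝ) (1 / 2), g x * η (x + s) := by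
    intro x
    rw [A_eq_integral_shift, intervalIntegral.integral_of_le (by norm_num), integral_const_mul]
  have e2 : ∀ x, A g x * η x = ∫ s in Set.Ioc (-(1 / 2) : ℝ) (1 / 2), g (x - s) * η x := by
    intro x
    rw [integral_mul_const, ← intervalIntegral.integral_of_le (by norm_num),
      intervalIntegral.integral_comp_sub_left (fun s => g s) x, A]
    congr 2; ring
  have hi1 := integrable_prod_shift hK hη hi
  have i1 : Integrable (fun z : ℝ × ℝ => g z.1 * η (z.1 + z.2))
      ((volume.restrict (cell K)).prod (volume.restrict (Set.Ioc (-(1 / 2) : ℝ) (1 / 2)))) :=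
    hi1.bdd_mul (c := M) (hgc.comp continuous_fst).aestronglyMeasurable
      (Eventually.of_forall fun z => hM _)
  have hi2 : Integrable (fun z : ℝ × ℝ => η z.1)
      ((volume.restrict (cell K)).prod (volume.restrict (Set.Ioc (-(1 / 2) : ℝ) (1 / 2)))) :=
    Integrable.comp_fst hi _
  have i2 : Integrable (fun z : ℝ × ℝ => g (z.1 - z.2) * η z.1)
      ((volume.restrict (cell K)).prod (volume.restrict (Set.Ioc (-(1 / 2) : ℝ) (1 / 2)))) :=
    hi2.bdd_mul (c := M) (hgc.comp (continuous_fst.sub continuous_snd)).aestronglyMeasurable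
      (Eventually.of_forall fun z => hM _)
  simp only [e1, e2]
  rw [integral_integral_swap (f := fun x s => g x * η (x + s)) i1,
    integral_integral_swap (f := fun x s => g (x - s) * η x) i2]
  congr 1
  ext s
  have hp : PerOn K (fun x => g (x - s) * η x) := by
    have := (hg.add_right (-s)).comp₂ hη (fun a b => a * b)
    simpa only [← sub_eq_add_neg] using this
  -- Shifting by `s` leaves the cell integral of a periodic function unchanged and turns `g (x - s)
  -- * η x` into `g x * η (x + s)`.
  rw [← hp.integral_cell_add hK s]
  simp

theorem integral_A {K : EReal} (hK : 1 ≤ K) {η : ℝ → ℝ} (hη : PerOn K η)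
    (hi : IntegrableOn η (cell K)) : ∫ x in cell K, A η x = ∫ x in cell K, η x := by
  have := integral_mul_A hK (g := fun _ => 1) (perOn_const K 1) continuous_const (M := 1)
    (by simp) hη hi
  simpa [A_const] using this

/-! ### Square-integrable functions on a cell -/

theorem memLp_iff_integrable_abs_rpow {μ : Measure ℝ} {f : ℝ → ℝ} {r : ℝ} (hr : 0 < r)
    (hf : AEStronglyMeasurable f μ) :
    MemLp f (ENNReal.ofReal r) μ ↔ Integrable (fun x => |f x| ^ r) μ := by
  have := integrable_norm_rpow_iff (μ := μ) (f := f) (p := ENNReal.ofReal r) hf (by simpa)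
    ENNReal.ofReal_ne_top
  rw [← this, ENNReal.toReal_ofReal hr.le]
  rfl

section L2

variable {K : EReal} {W : ℝ → ℝ}

theorem MemLpCell.perOn {r : ℝ} (h : MemLpCell K r W) : PerOn K W := h.1

theorem MemLpCell.memLp_two (h : MemLpCell K 2 W) : MemLp W 2 (volume.restrict (cell K)) := by
  simpa using h.2

theorem MemLpCell.integrableOn_sq (h : MemLpCell K 2 W) :
    IntegrableOn (fun x => W x ^ 2) (cell K) :=
  h.memLp_two.integrable_sq

theorem MemLpCell.locallyIntegrable_sq (hK : 1 ≤ K) (h : MemLpCell K 2 W) :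
    LocallyIntegrable (fun x => W x ^ 2) volume :=
  (h.perOn.comp (fun y => y ^ 2)).locallyIntegrable hK h.integrableOn_sq

theorem MemLpCell.locallyIntegrable (hK : 1 ≤ K) (h : MemLpCell K 2 W) :
    LocallyIntegrable W volume := by
  obtain rfl | ⟨k, hk, rfl⟩ := eq_top_or_exists_coe hK
  · have := h.memLp_two
    rw [cell_top, Measure.restrict_univ] at this
    exact this.locallyIntegrable (by norm_num)
  · refine h.perOn.locallyIntegrable hK ?_
    have := h.memLp_two
    rw [cell_coe] at *
    exact this.integrable (by norm_num)

theorem normSq_nonneg (K : EReal) (W : ℝ → ℝ) : 0 ≤ normSq K W :=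
  integral_nonneg fun _ => sq_nonneg _

theorem potential_nonneg (r : ℝ) (K : EReal) (W : ℝ → ℝ) : 0 ≤ potential r K W :=
  integral_nonneg fun _ => Real.rpow_nonneg (abs_nonneg _) _

theorem MemLpCell.integral_sq_le (hK : 1 ≤ K) (h : MemLpCell K 2 W) {a b : ℝ} (hab : a ≤ b)
    (hb : b ≤ a + 1) : ∫ s in a..b, W s ^ 2 ≤ normSq K W :=
  (h.perOn.comp (fun y => y ^ 2)).integral_window_le hK h.integrableOn_sq
    (fun _ => sq_nonneg _) hab hb

theorem MemLpCell.sq_A_le (hK : 1 ≤ K) (h : MemLpCell K 2 W) (x : ℝ) :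
    A W x ^ 2 ≤ A (fun y => W y ^ 2) x := by
  have := sq_integral_le (h.locallyIntegrable hK) (h.locallyIntegrable_sq hK)
    (a := x - 1 / 2) (b := x + 1 / 2) (by linarith)
  rw [show (x + 1 / 2 - (x - 1 / 2)) = 1 by ring, one_mul] at this
  exact this

theorem MemLpCell.abs_A_le (hK : 1 ≤ K) (h : MemLpCell K 2 W) (x : ℝ) :
    |A W x| ≤ √(normSq K W) := by
  refine Real.abs_le_sqrt ((h.sq_A_le hK x).trans ?_)
  exact h.integral_sq_le hK (by linarith) (by linarith)

theorem MemLpCell.continuous_A (hK : 1 ≤ K) (h : MemLpCell K 2 W) : Continuous (A W) :=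
  FPU.continuous_A (h.locallyIntegrable hK)

theorem MemLpCell.integrableOn_sq_A (hK : 1 ≤ K) (h : MemLpCell K 2 W) :
    IntegrableOn (fun x => A W x ^ 2) (cell K) := by
  refine Integrable.mono' (integrableOn_A hK (h.perOn.comp (fun y => y ^ 2)) h.integrableOn_sq)
    ((h.continuous_A hK).pow 2).aestronglyMeasurable (Eventually.of_forall fun x => ?_)
  rw [Real.norm_of_nonneg (sq_nonneg _)]
  exact h.sq_A_le hK x

/-- Averaging is an `L²` contraction: Cauchy–Schwarz holds pointwise, and `A` preserves the cell
integral. -/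
theorem MemLpCell.integral_sq_A_le (hK : 1 ≤ K) (h : MemLpCell K 2 W) :
    ∫ x in cell K, A W x ^ 2 ≤ normSq K W := by
  rw [normSq, ← integral_A hK (h.perOn.comp (fun y => y ^ 2)) h.integrableOn_sq]
  exact integral_mono (h.integrableOn_sq_A hK)
    (integrableOn_A hK (h.perOn.comp (fun y => y ^ 2)) h.integrableOn_sq) (h.sq_A_le hK)

/-- The two windows differ by two intervals of length `y - x`, and Cauchy–Schwarz applies on each.
This modulus of continuity, uniform in `K`, supplies the compactness. -/
theorem MemLpCell.abs_A_sub_le (hK : 1 ≤ K) (h : MemLpCell K 2 W) {x y : ℝ} (hxy : x ≤ y)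
    (hy : y ≤ x + 1) : |A W y - A W x| ≤ 2 * √(y - x) * √(normSq K W) := by
  have hl := h.locallyIntegrable hK
  have e : A W y - A W x = (∫ s in (x + 1 / 2)..(y + 1 / 2), W s)
      - ∫ s in (x - 1 / 2)..(y - 1 / 2), W s := by
    simp only [A]
    exact intervalIntegral.integral_interval_sub_interval_comm'
      (LocallyIntegrable.intervalIntegrable hl _ _)
      (LocallyIntegrable.intervalIntegrable hl _ _)
      (LocallyIntegrable.intervalIntegrable hl _ _)
  have key : ∀ c, |∫ s in (x + c)..(y + c), W s| ≤ √(y - x) * √(normSq K W) := by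
    intro c
    rw [← Real.sqrt_mul (by linarith)]
    refine Real.abs_le_sqrt ((sq_integral_le hl (h.locallyIntegrable_sq hK)
      (by linarith)).trans ?_)
    rw [show y + c - (x + c) = y - x by ring]
    exact mul_le_mul_of_nonneg_left (h.integral_sq_le hK (by linarith) (by linarith))
      (by linarith)
  have k1 := key (1 / 2)
  have k2 := key (-(1 / 2))
  simp only [← sub_eq_add_neg] at k2
  rw [e]
  rw [abs_le] at *
  constructor <;> linarith

theorem MemLpCell.ae_eq_zero (hK : 1 ≤ K) (h : MemLpCell K 2 W) (h0 : normSq K W = 0) :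
    W =ᵐ[volume] 0 := by
  have := (h.perOn.comp (fun y => y ^ 2)).ae_eq_zero hK h.integrableOn_sq
    (fun _ => sq_nonneg _) h0
  exact this.mono fun x hx => by simpa using hx

end L2

/-! ### The nonlinearities -/

/-- The sign function jumps at zero; splitting into positive and negative parts makes the continuity
of `Psi` visible there. -/
theorem Psi_eq {r : ℝ} (hr : 1 < r) (w : ℝ) :
    Psi r w = r * ((max w 0) ^ (r - 1) - (max (-w) 0) ^ (r - 1)) := by
  have h0 : (0 : ℝ) ^ (r - 1) = 0 := Real.zero_rpow (by linarith)
  rcases lt_trichotomy w 0 with h | rfl | h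
  · simp [Psi, h, h.le, abs_of_neg, h0]
  · simp [Psi, h0]
  · simp [Psi, h, h.le, abs_of_pos, h0]

theorem continuous_Psi {r : ℝ} (hr : 1 < r) : Continuous (Psi r) := by
  have : Psi r = fun w => r * ((max w 0) ^ (r - 1) - (max (-w) 0) ^ (r - 1)) :=
    funext (Psi_eq hr)
  rw [this]
  have h : ∀ {f : ℝ → ℝ}, Continuous f → Continuous fun w => f w ^ (r - 1) := fun hf =>
    hf.rpow_const fun _ => Or.inr (by linarith)
  exact continuous_const.mul ((h (by fun_prop)).sub (h (by fun_prop)))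

theorem Psi_mul_self {r : ℝ} (hr : 1 < r) (w : ℝ) : Psi r w * w = r * |w| ^ r := by
  rcases eq_or_ne w 0 with rfl | h
  · simp [Psi, Real.zero_rpow (by linarith : r ≠ 0)]
  · have h1 : |w| ^ r = |w| ^ (r - 1) * |w| := by
      rw [Real.rpow_sub_one (abs_ne_zero.2 h)]; field_simp
    have h2 : (SignType.sign w : ℝ) * w = |w| := sign_mul_self w
    rw [h1, Psi, ← h2]; ring

theorem abs_Psi_le {r : ℝ} (hr : 1 < r) {w M : ℝ} (hw : |w| ≤ M) : |Psi r w| ≤ r * M ^ (r - 1) := by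
  have hs : |(SignType.sign w : ℝ)| ≤ 1 := by
    rcases lt_trichotomy w 0 with h | rfl | h <;> simp [*]
  have h1 : |w| ^ (r - 1) ≤ M ^ (r - 1) :=
    Real.rpow_le_rpow (abs_nonneg _) hw (by linarith)
  have h0 : 0 ≤ |w| ^ (r - 1) := Real.rpow_nonneg (abs_nonneg _) _
  rw [Psi, abs_mul, abs_mul, abs_of_pos (by linarith : 0 < r), abs_of_nonneg h0, mul_assoc]
  refine mul_le_mul_of_nonneg_left ?_ (by linarith)
  nlinarith

theorem hasDerivAt_abs_rpow_Psi {r : ℝ} (hr : 1 < r) (w : ℝ) :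
    HasDerivAt (fun x => |x| ^ r) (Psi r w) w := by
  convert hasDerivAt_abs_rpow w hr using 1
  rcases eq_or_ne w 0 with rfl | h
  · simp [Psi]
  · have h1 : |w| ^ (r - 1) = |w| ^ (r - 2) * |w| := by
      have := Real.rpow_add_one (abs_ne_zero.2 h) (r - 2)
      rwa [show r - 2 + 1 = r - 1 by ring] at this
    have h2 : (SignType.sign w : ℝ) * |w| = w := sign_mul_abs w
    rw [Psi, h1]
    linear_combination (r * |w| ^ (r - 2)) * h2

/-! ### The fibre map -/

section Fibre

variable {p q a Q P t : ℝ}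

/-- Bernoulli's inequality for the base `t ^ r` and the exponent `p / r ≥ 1`. -/
theorem rpow_sub_rpow_le {r : ℝ} (hr : 0 < r) (hrp : r ≤ p) (ht : 0 ≤ t) :
    t ^ r - r / p * t ^ p ≤ 1 - r / p := by
  have hp : 0 < p := by linarith
  have h := one_add_mul_self_le_rpow_one_add (s := t ^ r - 1)
    (by linarith [Real.rpow_nonneg ht r]) (p := p / r) (by rwa [one_le_div hr])
  rw [add_sub_cancel, ← Real.rpow_mul ht, mul_div_cancel₀ _ hr.ne'] at h
  have h2 : r / p * (1 + p / r * (t ^ r - 1)) ≤ r / p * t ^ p :=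
    mul_le_mul_of_nonneg_left h (by positivity)
  have h3 : r / p * (1 + p / r * (t ^ r - 1)) = r / p + (t ^ r - 1) := by field_simp
  linarith

/-- The fibre map attains its maximum on the Nehari manifold. -/
theorem fibre_le (hp : 2 < p) (hq : 1 < q) (hqp : q < p) (ha : 0 ≤ a) (hQ : 0 ≤ Q)
    (h : a + q * Q - p * P = 0) (ht : 0 ≤ t) :
    1 / 2 * a * t ^ 2 + Q * t ^ q - P * t ^ p ≤ 1 / 2 * a + Q - P := by
  have h1 := rpow_sub_rpow_le (p := p) (r := 2) two_pos hp.le ht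
  have h2 := rpow_sub_rpow_le (p := p) (r := q) (by linarith) hqp.le ht
  rw [Real.rpow_two] at h1
  -- With `P` eliminated, the claim splits into the cases `r = 2` and `r = q` of `rpow_sub_rpow_le`,
  -- weighted by `a / 2` and `Q`.
  have hP : P = a / p + q * Q / p := by
    rw [← add_div, eq_div_iff (by linarith)]; linarith
  have e1 := mul_le_mul_of_nonneg_left h1 (by linarith : 0 ≤ a / 2)
  have e2 := mul_le_mul_of_nonneg_left h2 hQ
  rw [hP]
  have e3 : a / 2 * (t ^ 2 - 2 / p * t ^ p) = 1 / 2 * a * t ^ 2 - a / p * t ^ p := by ring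
  have e4 : Q * (t ^ q - q / p * t ^ p) = Q * t ^ q - q * Q / p * t ^ p := by ring
  have e5 : a / 2 * (1 - 2 / p) = 1 / 2 * a - a / p := by ring
  have e6 : Q * (1 - q / p) = Q - q * Q / p := by ring
  linarith

theorem exists_fibre_root (hp : 2 < p) (hq : 1 < q) (hqp : q < p) (ha : 0 < a) (hQ : 0 ≤ Q)
    (hP : 0 < P) : ∃ t : ℝ, 0 < t ∧ a * t ^ 2 + q * Q * t ^ q - p * P * t ^ p = 0 := by
  -- Dividing by `t ^ p` leaves only negative powers besides the constant `-p * P`, so the limit at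
  -- infinity is negative.
  set g : ℝ → ℝ := fun t => a * t ^ (-(p - 2)) + q * Q * t ^ (-(p - q)) - p * P with hg
  have hlim : Tendsto g atTop (𝓝 (a * 0 + q * Q * 0 - p * P)) :=
    (((tendsto_rpow_neg_atTop (by linarith)).const_mul a).add
      ((tendsto_rpow_neg_atTop (by linarith)).const_mul (q * Q))).sub_const _
  have hpP : 0 < p * P := by positivity
  -- Chosen so that the quadratic term of `g u` equals `2 * (p * P)`, which outweighs the constant.
  set u : ℝ := (2 * (p * P) / a) ^ (-(1 / (p - 2))) with hu
  have hu0 : 0 < u := by positivity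
  have hgu : 0 < g u := by
    have : u ^ (-(p - 2)) = 2 * (p * P) / a := by
      rw [hu, ← Real.rpow_mul (by positivity)]
      have : -(1 / (p - 2)) * -(p - 2) = 1 := by
        have : p - 2 ≠ 0 := by linarith
        field_simp
      rw [this, Real.rpow_one]
    have h2 : 0 ≤ q * Q * u ^ (-(p - q)) := by positivity
    simp only [hg, this]
    have : a * (2 * (p * P) / a) = 2 * (p * P) := by field_simp
    linarith
  obtain ⟨v, hv, huv⟩ := ((hlim.eventually_lt_const (u := 0) (by linarith)).and
    (eventually_ge_atTop u)).exists
  have hcont : ContinuousOn g (Set.Icc u v) := by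
    refine ContinuousOn.sub (ContinuousOn.add ?_ ?_) continuousOn_const <;>
    exact continuousOn_const.mul (continuousOn_id.rpow_const fun x hx =>
      Or.inl (hu0.trans_le hx.1).ne')
  obtain ⟨t, ht, ht0⟩ := intermediate_value_Icc' huv hcont ⟨hv.le, hgu.le⟩
  have htpos : 0 < t := hu0.trans_le ht.1
  refine ⟨t, htpos, ?_⟩
  have e1 : t ^ 2 = t ^ (-(p - 2)) * t ^ p := by
    rw [← Real.rpow_add htpos, ← Real.rpow_two]; congr 1; ring
  have e2 : t ^ q = t ^ (-(p - q)) * t ^ p := by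
    rw [← Real.rpow_add htpos]; congr 1; ring
  simp only [hg] at ht0
  rw [e1, e2]
  linear_combination t ^ p * ht0

/-- Writing `u = c * t` with `c ≥ 1`, the lower-order terms grow at most by the factor `c ^ p` of
the leading term, so the expression cannot be positive beyond a root. The companion
`fibre_root_lt_of_neg` is the mirror image with `c ≤ 1`. -/
theorem lt_fibre_root_of_pos (hp : 2 < p) (hq : 1 < q) (hqp : q < p) (ha : 0 ≤ a) (hQ : 0 ≤ Q)
    (ht : 0 < t) (h : a * t ^ 2 + q * Q * t ^ q - p * P * t ^ p = 0) {u : ℝ}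
    (hu : 0 < a * u ^ 2 + q * Q * u ^ q - p * P * u ^ p) : u < t := by
  by_contra! hle
  obtain ⟨c, hc, rfl⟩ : ∃ c, 1 ≤ c ∧ u = c * t := ⟨u / t, by rwa [one_le_div ht], by field_simp⟩
  have hc0 : 0 ≤ c := by linarith
  rw [mul_pow, Real.mul_rpow hc0 ht.le, Real.mul_rpow hc0 ht.le] at hu
  have h2 : c ^ 2 ≤ c ^ p := by
    rw [← Real.rpow_two]; exact Real.rpow_le_rpow_of_exponent_le hc hp.le
  have hq' : c ^ q ≤ c ^ p := Real.rpow_le_rpow_of_exponent_le hc hqp.le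
  have k1 : 0 ≤ a * t ^ 2 := by positivity
  have k2 : 0 ≤ q * Q * t ^ q := by positivity
  have e : p * P * (c ^ p * t ^ p) = c ^ p * (a * t ^ 2 + q * Q * t ^ q) := by
    rw [show a * t ^ 2 + q * Q * t ^ q = p * P * t ^ p by linarith]; ring
  nlinarith [mul_le_mul_of_nonneg_left h2 k1, mul_le_mul_of_nonneg_left hq' k2]

theorem fibre_root_lt_of_neg (hp : 2 < p) (hq : 1 < q) (hqp : q < p) (ha : 0 ≤ a) (hQ : 0 ≤ Q)
    (ht : 0 < t) (h : a * t ^ 2 + q * Q * t ^ q - p * P * t ^ p = 0) {u : ℝ} (hu0 : 0 < u)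
    (hu : a * u ^ 2 + q * Q * u ^ q - p * P * u ^ p < 0) : t < u := by
  by_contra! hle
  obtain ⟨c, hc0, hc, rfl⟩ : ∃ c, 0 < c ∧ c ≤ 1 ∧ u = c * t :=
    ⟨u / t, by positivity, by rwa [div_le_one ht], by field_simp⟩
  rw [mul_pow, Real.mul_rpow hc0.le ht.le, Real.mul_rpow hc0.le ht.le] at hu
  have h2 : c ^ p ≤ c ^ 2 := by
    rw [← Real.rpow_two]; exact Real.rpow_le_rpow_of_exponent_ge hc0 hc hp.le
  have hq' : c ^ p ≤ c ^ q := Real.rpow_le_rpow_of_exponent_ge hc0 hc hqp.le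
  have k1 : 0 ≤ a * t ^ 2 := by positivity
  have k2 : 0 ≤ q * Q * t ^ q := by positivity
  have e : p * P * (c ^ p * t ^ p) = c ^ p * (a * t ^ 2 + q * Q * t ^ q) := by
    rw [show a * t ^ 2 + q * Q * t ^ q = p * P * t ^ p by linarith]; ring
  nlinarith [mul_le_mul_of_nonneg_left h2 k1, mul_le_mul_of_nonneg_left hq' k2]

theorem fibre_neg_of_one_lt (hp : 2 < p) (hqp : q < p) (ha : 0 < a) (hQ : 0 ≤ Q) (hq : 1 < q)
    (h : a + q * Q - p * P = 0) {u : ℝ} (hu : 1 < u) :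
    a * u ^ 2 + q * Q * u ^ q - p * P * u ^ p < 0 := by
  have h2 : u ^ 2 < u ^ p := by
    rw [← Real.rpow_two]; exact Real.rpow_lt_rpow_of_exponent_lt hu hp
  have hq' : u ^ q ≤ u ^ p := Real.rpow_le_rpow_of_exponent_le hu.le hqp.le
  have k2 : 0 ≤ q * Q := by positivity
  have e : p * P = a + q * Q := by linarith
  rw [e]
  nlinarith [mul_lt_mul_of_pos_left h2 ha, mul_le_mul_of_nonneg_left hq' k2]

theorem fibre_pos_of_lt_one (hp : 2 < p) (hqp : q < p) (ha : 0 < a) (hQ : 0 ≤ Q) (hq : 1 < q)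
    (h : a + q * Q - p * P = 0) {u : ℝ} (hu0 : 0 < u) (hu : u < 1) :
    0 < a * u ^ 2 + q * Q * u ^ q - p * P * u ^ p := by
  have h2 : u ^ p < u ^ 2 := by
    rw [← Real.rpow_two]; exact Real.rpow_lt_rpow_of_exponent_gt hu0 hu hp
  have hq' : u ^ p ≤ u ^ q := Real.rpow_le_rpow_of_exponent_ge hu0 hu.le hqp.le
  have k2 : 0 ≤ q * Q := by positivity
  have e : p * P = a + q * Q := by linarith
  rw [e]
  nlinarith [mul_lt_mul_of_pos_left h2 ha, mul_le_mul_of_nonneg_left hq' k2]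

/-- The limit fibre is positive before 1 and negative after 1. At any fixed `u ≠ 1` the
approximating fibres inherit this sign eventually, which traps their roots without an a priori bound
on `tn`. -/
theorem tendsto_fibre_root {ι : Type*} {l : Filter ι} (hp : 2 < p) (hq : 1 < q) (hqp : q < p)
    {an Qn Pn tn : ι → ℝ} (ha : 0 < a) (hQ : 0 ≤ Q) (h : a + q * Q - p * P = 0)
    (hat : Tendsto an l (𝓝 a)) (hQt : Tendsto Qn l (𝓝 Q)) (hPt : Tendsto Pn l (𝓝 P))
    (han : ∀ i, 0 ≤ an i) (hQn : ∀ i, 0 ≤ Qn i)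
    (ht : ∀ᶠ i in l, 0 < tn i ∧
      an i * tn i ^ 2 + q * Qn i * tn i ^ q - p * Pn i * tn i ^ p = 0) :
    Tendsto tn l (𝓝 1) := by
  have hlim : ∀ u : ℝ, Tendsto (fun i => an i * u ^ 2 + q * Qn i * u ^ q - p * Pn i * u ^ p) l
      (𝓝 (a * u ^ 2 + q * Q * u ^ q - p * P * u ^ p)) := fun u =>
    ((hat.mul_const _).add ((hQt.const_mul _).mul_const _)).sub ((hPt.const_mul _).mul_const _)
  rw [tendsto_order]
  constructor
  · intro u hu
    rcases le_or_gt u 0 with hu0 | hu0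
    · exact ht.mono fun i hi => hu0.trans_lt hi.1
    · filter_upwards [ht, (hlim u).eventually_const_lt
        (fibre_pos_of_lt_one hp hqp ha hQ hq h hu0 hu)] with i hi hi2
      exact lt_fibre_root_of_pos hp hq hqp (han i) (hQn i) hi.1 hi.2 hi2
  · intro u hu
    filter_upwards [ht, (hlim u).eventually_lt_const
        (fibre_neg_of_one_lt hp hqp ha hQ hq h hu)] with i hi hi2
    exact fibre_root_lt_of_neg hp hq hqp (han i) (hQn i) hi.1 hi.2 (by linarith) hi2

end Fibre

/-! ### The ansatz space and its scaling behaviour -/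

section Space

variable {σ p q : ℝ} {K : EReal} {W : ℝ → ℝ}

theorem abs_rpow_le {r w M : ℝ} (hr : 2 ≤ r) (hw : |w| ≤ M) : |w| ^ r ≤ M ^ (r - 2) * w ^ 2 := by
  have h : |w| ^ r = |w| ^ (r - 2) * w ^ 2 := by
    rw [← sq_abs w, ← Real.rpow_two, ← Real.rpow_add' (abs_nonneg _) (by linarith)]
    congr 1; ring
  rw [h]
  exact mul_le_mul_of_nonneg_right (Real.rpow_le_rpow (abs_nonneg _) hw (by linarith))
    (sq_nonneg _)

theorem X.integrableOn_potential {r : ℝ} (hr : 0 < r) (hK : 1 ≤ K) (h : MemLpCell K 2 W)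
    (h2 : MemLpCell K r (A W)) : IntegrableOn (fun x => |A W x| ^ r) (cell K) :=
  (memLp_iff_integrable_abs_rpow hr (h.continuous_A hK).aestronglyMeasurable).1 h2.2

theorem MemLpCell.memLpCell_A {r : ℝ} (hr : 0 < r) (hK : 1 ≤ K) (h : MemLpCell K 2 W)
    (hi : IntegrableOn (fun x => |A W x| ^ r) (cell K)) : MemLpCell K r (A W) :=
  ⟨h.perOn.A, (memLp_iff_integrable_abs_rpow hr (h.continuous_A hK).aestronglyMeasurable).2 hi⟩

theorem MemLpCell.integrableOn_abs_A_rpow {r : ℝ} (hr : 2 ≤ r) (hK : 1 ≤ K)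
    (h : MemLpCell K 2 W) : IntegrableOn (fun x => |A W x| ^ r) (cell K) := by
  refine Integrable.mono' ((h.integrableOn_sq_A hK).const_mul (√(normSq K W) ^ (r - 2)))
    ((h.continuous_A hK).abs.rpow_const fun _ => Or.inr (by linarith)).aestronglyMeasurable
    (Eventually.of_forall fun x => ?_)
  rw [Real.norm_of_nonneg (Real.rpow_nonneg (abs_nonneg _) _)]
  exact abs_rpow_le hr (h.abs_A_le hK x)

/-- Membership in `X` only requires square-integrability and the `q`-integrability of `A W`. -/
theorem mem_X_iff (hp : 2 < p) (hq : 1 < q) (hK : 1 ≤ K) :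
    W ∈ X p q K ↔ MemLpCell K 2 W ∧ IntegrableOn (fun x => |A W x| ^ q) (cell K) := by
  constructor
  · rintro ⟨h1, h2, -⟩
    exact ⟨h1, X.integrableOn_potential (by linarith) hK h1 h2⟩
  · rintro ⟨h1, h2⟩
    exact ⟨h1, h1.memLpCell_A (by linarith) hK h2,
      h1.memLpCell_A (by linarith) hK (h1.integrableOn_abs_A_rpow hp.le hK)⟩

/-- On a bounded cell, `X` is the whole space of square-integrable functions. -/
theorem mem_X_coe (hp : 2 < p) (hq : 1 < q) {k : ℝ} (hk : 1 ≤ k) (h : MemLpCell k 2 W) :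
    W ∈ X p q k := by
  have hK : (1 : EReal) ≤ k := by exact_mod_cast hk
  refine (mem_X_iff hp hq hK).2 ⟨h, ?_⟩
  rw [cell_coe]
  refine (Continuous.integrableOn_Icc ?_).mono_set Set.Ioc_subset_Icc_self
  exact (h.continuous_A hK).abs.rpow_const fun _ => Or.inr (by linarith)

theorem MemLpCell.const_mul {r : ℝ} (h : MemLpCell K r W) (c : ℝ) :
    MemLpCell K r (fun x => c * W x) :=
  ⟨h.perOn.comp (fun y => c * y), h.2.const_mul c⟩

theorem MemLpCell.add {r : ℝ} {V : ℝ → ℝ} (h : MemLpCell K r W) (h' : MemLpCell K r V) :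
    MemLpCell K r (fun x => W x + V x) :=
  ⟨h.perOn.comp₂ h'.perOn (fun x y => x + y), h.2.add h'.2⟩

theorem const_mul_mem_X (h : W ∈ X p q K) (c : ℝ) : (fun x => c * W x) ∈ X p q K := by
  have : A (fun x => c * W x) = fun x => c * A W x := funext (A_const_mul c W)
  refine ⟨h.1.const_mul c, ?_, ?_⟩ <;> rw [this]
  exacts [h.2.1.const_mul c, h.2.2.const_mul c]

theorem normSq_const_mul (K : EReal) (c : ℝ) (W : ℝ → ℝ) :
    normSq K (fun x => c * W x) = c ^ 2 * normSq K W := by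
  simp only [normSq, mul_pow, integral_const_mul]

theorem potential_const_mul (r : ℝ) (K : EReal) {c : ℝ} (hc : 0 ≤ c) (W : ℝ → ℝ) :
    potential r K (fun x => c * W x) = c ^ r * potential r K W := by
  simp only [potential, A_const_mul, abs_mul, abs_of_nonneg hc,
    Real.mul_rpow hc (abs_nonneg _), integral_const_mul]

theorem action_const_mul (σ p q : ℝ) (K : EReal) {c : ℝ} (hc : 0 ≤ c) (W : ℝ → ℝ) :
    action σ p q K (fun x => c * W x) = 1 / 2 * (σ ^ 2 * normSq K W) * c ^ 2
      + potential q K W * c ^ q - potential p K W * c ^ p := by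
  simp only [action, normSq_const_mul, potential_const_mul _ _ hc]; ring

theorem nehariFunctional_const_mul (σ p q : ℝ) (K : EReal) {c : ℝ} (hc : 0 ≤ c) (W : ℝ → ℝ) :
    nehariFunctional σ p q K (fun x => c * W x) = (σ ^ 2 * normSq K W) * c ^ 2
      + q * potential q K W * c ^ q - p * potential p K W * c ^ p := by
  simp only [nehariFunctional, normSq_const_mul, potential_const_mul _ _ hc]; ring

theorem MemLpCell.normSq_pos (hK : 1 ≤ K) (h : MemLpCell K 2 W) (h0 : ¬ W =ᵐ[volume] 0) :
    0 < normSq K W :=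
  (normSq_nonneg K W).lt_of_ne fun h1 => h0 (h.ae_eq_zero hK h1.symm)

theorem not_ae_eq_zero_of_normSq_pos (h : 0 < normSq K W) : ¬ W =ᵐ[volume] 0 := fun h0 => by
  have : normSq K W = ∫ x in cell K, (0 : ℝ) := by
    refine integral_congr_ae (ae_restrict_of_ae (h0.mono fun x hx => ?_))
    simp [hx]
  simp [this] at h

theorem MemLpCell.potential_le {r M : ℝ} (hr : 2 ≤ r) (hK : 1 ≤ K) (h : MemLpCell K 2 W)
    (hM0 : 0 ≤ M) (hM : ∀ x, |A W x| ≤ M) : potential r K W ≤ M ^ (r - 2) * normSq K W := by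
  calc potential r K W ≤ ∫ x in cell K, M ^ (r - 2) * A W x ^ 2 :=
        integral_mono (h.integrableOn_abs_A_rpow hr hK) ((h.integrableOn_sq_A hK).const_mul _)
          fun x => abs_rpow_le hr (hM x)
    _ = M ^ (r - 2) * ∫ x in cell K, A W x ^ 2 := integral_const_mul _ _
    _ ≤ _ := mul_le_mul_of_nonneg_left (h.integral_sq_A_le hK) (by positivity)

/-! ### The Nehari manifold -/

/-- Both coefficients are positive, so on the manifold the action controls the norm and the
`q`-potential separately, and the sign-indefinite `p`-term no longer appears. -/
theorem action_eq_of_nehari (hp : 2 < p) (h : W ∈ nehari σ p q K) :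
    action σ p q K W = (1 / 2 - 1 / p) * σ ^ 2 * normSq K W + (1 - q / p) * potential q K W := by
  have h1 : potential p K W = (σ ^ 2 * normSq K W + q * potential q K W) / p := by
    rw [eq_div_iff (by linarith)]
    have := h.2.2
    simp only [nehariFunctional] at this
    linarith
  rw [action, h1]; ring

theorem action_nonneg_of_nehari (hp : 2 < p) (hqp : q < p) (h : W ∈ nehari σ p q K) :
    0 ≤ action σ p q K W := by
  rw [action_eq_of_nehari hp h]
  have h1 : 1 / p ≤ 1 / 2 := one_div_le_one_div_of_le two_pos hp.le
  have h2 : q / p ≤ 1 := (div_le_one (by linarith)).2 hqp.le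
  have := normSq_nonneg K W
  have := potential_nonneg q K W
  have : 0 ≤ 1 / 2 - 1 / p := by linarith
  have : 0 ≤ 1 - q / p := by linarith
  positivity

theorem ell_le (hp : 2 < p) (hqp : q < p) (h : W ∈ nehari σ p q K) :
    ell σ p q K ≤ action σ p q K W := by
  refine csInf_le ⟨0, ?_⟩ ⟨W, h, rfl⟩
  rintro _ ⟨V, hV, rfl⟩
  exact action_nonneg_of_nehari hp hqp hV

theorem isMinOn_iff_action_le_ell (hp : 2 < p) (hqp : q < p) (h : W ∈ nehari σ p q K) :
    IsMinOn (action σ p q K) (nehari σ p q K) W ↔ action σ p q K W ≤ ell σ p q K := by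
  constructor
  · intro hm
    refine le_csInf ⟨_, W, h, rfl⟩ ?_
    rintro _ ⟨V, hV, rfl⟩
    exact hm hV
  · intro hm V hV
    exact hm.trans (ell_le hp hqp hV)

theorem nehari.potential_pos (hσ : 0 < σ ^ 2) (hp : 2 < p) (hq : 1 < q) (hK : 1 ≤ K)
    (h : W ∈ nehari σ p q K) : 0 < potential p K W := by
  have h1 := h.1.1.normSq_pos hK h.2.1
  have h2 := h.2.2
  simp only [nehariFunctional] at h2
  have h3 := potential_nonneg q K W
  have h4 : 0 < σ ^ 2 * normSq K W := by positivity
  have h5 : 0 ≤ q * potential q K W := by positivity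
  have h6 : 0 < p * potential p K W := by linarith
  exact (mul_pos_iff_of_pos_left (by linarith)).1 h6

/-- A uniform lower bound for the amplitude of `A W` on the Nehari manifold. -/
theorem nehari.exists_le_abs_A (hp : 2 < p) (hq : 1 < q) (hK : 1 ≤ K)
    (h : W ∈ nehari σ p q K) {δ : ℝ} (hδ0 : 0 ≤ δ) (hδ : p * δ ^ (p - 2) < σ ^ 2) :
    ∃ x, δ ≤ |A W x| := by
  by_contra! hlt
  have h1 := h.1.1.normSq_pos hK h.2.1
  have h2 := h.2.2
  simp only [nehariFunctional] at h2
  have h3 := potential_nonneg q K W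
  have h5 : 0 ≤ q * potential q K W := by positivity
  -- If `|A W|` stayed below `δ`, the `p`-term would be at most `p * δ ^ (p - 2)` times the squared
  -- norm, too small to balance `σ ^ 2 * normSq K W`.
  have h6 := h.1.1.potential_le hp.le hK hδ0 fun x => (hlt x).le
  have h7 : p * potential p K W ≤ p * (δ ^ (p - 2) * normSq K W) :=
    mul_le_mul_of_nonneg_left h6 (by linarith)
  nlinarith [mul_lt_mul_of_pos_right hδ h1]

/-- The threshold depends on `σ` and `p` alone, so the lower bounds derived from it hold on all
cells simultaneously. -/
theorem exists_amplitude (hσ : 0 < σ ^ 2) (hp : 2 < p) :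
    ∃ δ : ℝ, 0 < δ ∧ p * δ ^ (p - 2) < σ ^ 2 := by
  have hc : Tendsto (fun δ : ℝ => p * δ ^ (p - 2)) (𝓝[>] 0) (𝓝 (p * 0 ^ (p - 2))) :=
    (((continuous_id.rpow_const fun _ => Or.inr (by linarith)).tendsto 0).const_mul p).mono_left
      nhdsWithin_le_nhds
  rw [Real.zero_rpow (by linarith), mul_zero] at hc
  obtain ⟨δ, h1, h2⟩ := ((hc.eventually_lt_const hσ).and self_mem_nhdsWithin).exists
  exact ⟨δ, h2, h1⟩

theorem nehari.le_normSq (hp : 2 < p) (hq : 1 < q) (hK : 1 ≤ K)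
    (h : W ∈ nehari σ p q K) {δ : ℝ} (hδ0 : 0 ≤ δ) (hδ : p * δ ^ (p - 2) < σ ^ 2) :
    δ ^ 2 ≤ normSq K W := by
  obtain ⟨x, hx⟩ := nehari.exists_le_abs_A hp hq hK h hδ0 hδ
  have := hx.trans (h.1.1.abs_A_le hK x)
  exact (Real.le_sqrt hδ0 (normSq_nonneg _ _)).1 this

/-- Every `W ∈ X` with `A W ≠ 0` has a positive multiple on the Nehari manifold. -/
theorem exists_const_mul_mem_nehari (hσ : 0 < σ ^ 2) (hp : 2 < p) (hq : 1 < q) (hqp : q < p)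
    (hK : 1 ≤ K) (h : W ∈ X p q K) (hP : 0 < potential p K W) :
    ∃ t : ℝ, 0 < t ∧ (σ ^ 2 * normSq K W) * t ^ 2 + q * potential q K W * t ^ q
      - p * potential p K W * t ^ p = 0 ∧ (fun x => t * W x) ∈ nehari σ p q K := by
  have hN : 0 < normSq K W := by
    refine (normSq_nonneg K W).lt_of_ne fun h0 => ?_
    have := h.1.potential_le hp.le hK (Real.sqrt_nonneg _) (h.1.abs_A_le hK)
    rw [← h0, mul_zero] at this
    linarith
  obtain ⟨t, ht, h0⟩ := exists_fibre_root hp hq hqp (mul_pos hσ hN) (potential_nonneg q K W) hP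
  refine ⟨t, ht, h0, const_mul_mem_X h t, not_ae_eq_zero_of_normSq_pos (K := K) ?_, ?_⟩
  · rw [normSq_const_mul]; positivity
  · rw [nehariFunctional_const_mul _ _ _ _ ht.le, h0]

end Space

/-! ### Minimizers solve the Euler–Lagrange equation -/

section EulerLagrange

variable {σ p q : ℝ} {K : EReal} {W η : ℝ → ℝ}

theorem memLp_Icc_of_continuous {f : ℝ → ℝ} (hf : Continuous f) (a b : ℝ) (r : ENNReal) :
    MemLp f r (volume.restrict (Set.Icc a b)) := by
  obtain ⟨C, hC⟩ := isCompact_Icc.exists_bound_of_continuousOn (s := Set.Icc a b) hf.continuousOn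
  exact MemLp.of_bound hf.aestronglyMeasurable C
    (ae_restrict_of_forall_mem measurableSet_Icc hC)

theorem MemLpCell.integrableOn_mul (h : MemLpCell K 2 W) (hη : MemLpCell K 2 η) :
    IntegrableOn (fun x => W x * η x) (cell K) :=
  MemLp.integrable_mul h.memLp_two hη.memLp_two

theorem normSq_add (h : MemLpCell K 2 W) (hη : MemLpCell K 2 η) (s : ℝ) :
    normSq K (fun x => W x + s * η x)
      = normSq K W + 2 * s * (∫ x in cell K, W x * η x) + s ^ 2 * normSq K η := by
  have e : ∀ x, (W x + s * η x) ^ 2 = W x ^ 2 + 2 * s * (W x * η x) + s ^ 2 * η x ^ 2 :=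
    fun x => by ring
  have i1 : Integrable (fun x => W x ^ 2) (volume.restrict (cell K)) := h.integrableOn_sq
  have i2 : Integrable (fun x => W x * η x) (volume.restrict (cell K)) := h.integrableOn_mul hη
  have i3 : Integrable (fun x => η x ^ 2) (volume.restrict (cell K)) := hη.integrableOn_sq
  have i4 : Integrable (fun x => W x ^ 2 + 2 * s * (W x * η x)) (volume.restrict (cell K)) :=
    i1.add (i2.const_mul _)
  simp only [normSq, e]
  rw [integral_add i4 (i3.const_mul _), integral_add i1 (i2.const_mul _),
    integral_const_mul, integral_const_mul]

theorem MemLpCell.abs_Psi_A_le {r : ℝ} (hr : 1 < r) (hK : 1 ≤ K) (h : MemLpCell K 2 W) :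
    ∀ x, |Psi r (A W x)| ≤ r * √(normSq K W) ^ (r - 1) := fun x =>
  abs_Psi_le hr (h.abs_A_le hK x)

theorem MemLpCell.continuous_Psi_A {r : ℝ} (hr : 1 < r) (hK : 1 ≤ K) (h : MemLpCell K 2 W) :
    Continuous fun x => Psi r (FPU.A W x) := (continuous_Psi hr).comp (h.continuous_A hK)

theorem MemLpCell.integrableOn_Psi_mul {r : ℝ} (hr : 1 < r) (hK : 1 ≤ K) (h : MemLpCell K 2 W)
    {f : ℝ → ℝ} (hf : IntegrableOn f (cell K)) :
    IntegrableOn (fun x => Psi r (FPU.A W x) * f x) (cell K) :=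
  Integrable.bdd_mul (c := r * √(normSq K W) ^ (r - 1)) hf
    (h.continuous_Psi_A hr hK).aestronglyMeasurable
    (Eventually.of_forall fun x => h.abs_Psi_A_le hr hK x)

theorem MemLpCell.integrableOn_A_Psi_mul {r : ℝ} (hr : 1 < r) (hK : 1 ≤ K) (h : MemLpCell K 2 W)
    {f : ℝ → ℝ} (hf : IntegrableOn f (cell K)) :
    IntegrableOn (fun x => FPU.A (fun s => Psi r (FPU.A W s)) x * f x) (cell K) :=
  Integrable.bdd_mul (c := r * √(normSq K W) ^ (r - 1)) hf
    (FPU.continuous_A (h.continuous_Psi_A hr hK).locallyIntegrable).aestronglyMeasurable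
    (Eventually.of_forall fun x => abs_A_le_of_bound (h.abs_Psi_A_le hr hK) x)

/-- The gradient represents the first variation of the action. -/
theorem integral_gradAction_mul (hp : 2 < p) (hq : 1 < q) (hK : 1 ≤ K) (h : MemLpCell K 2 W)
    (hη : MemLpCell K 2 η) (hi : IntegrableOn η (cell K)) :
    ∫ x in cell K, gradAction σ p q W x * η x = σ ^ 2 * (∫ x in cell K, W x * η x)
      + (∫ x in cell K, Psi q (A W x) * A η x) - ∫ x in cell K, Psi p (A W x) * A η x := by
  have hp1 : 1 < p := by linarith
  have e : ∀ x, gradAction σ p q W x * η x = σ ^ 2 * (W x * η x)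
      + A (fun s => Psi q (A W s)) x * η x - A (fun s => Psi p (A W s)) x * η x :=
    fun x => by rw [gradAction]; ring
  have i1 : Integrable (fun x => W x * η x) (volume.restrict (cell K)) := h.integrableOn_mul hη
  have i2 := h.integrableOn_A_Psi_mul hq hK hi
  have i3 := h.integrableOn_A_Psi_mul hp1 hK hi
  have i4 : Integrable (fun x => σ ^ 2 * (W x * η x) + A (fun s => Psi q (A W s)) x * η x)
    (volume.restrict (cell K)) := (i1.const_mul _).add i2
  simp only [e]
  rw [integral_sub i4 i3, integral_add (i1.const_mul _) i2,
    integral_const_mul,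
    integral_mul_A hK (h.perOn.A.comp (Psi q)) (h.continuous_Psi_A hq hK)
      (h.abs_Psi_A_le hq hK) hη.perOn hi,
    integral_mul_A hK (h.perOn.A.comp (Psi p)) (h.continuous_Psi_A hp1 hK)
      (h.abs_Psi_A_le hp1 hK) hη.perOn hi]

/-- `A η` is bounded, so all but one factor can be estimated by a constant. On the line with `r <
2`, square-integrability of `η` alone would not suffice. -/
theorem integrableOn_abs_A_rpow_of_integrableOn {r : ℝ} (hr : 1 < r) (hK : 1 ≤ K)
    (hη : MemLpCell K 2 η) (hi : IntegrableOn (A η) (cell K)) :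
    IntegrableOn (fun x => |A η x| ^ r) (cell K) := by
  refine Integrable.mono' (hi.norm.const_mul (√(normSq K η) ^ (r - 1)))
    ((hη.continuous_A hK).abs.rpow_const fun _ => Or.inr (by linarith)).aestronglyMeasurable
    (Eventually.of_forall fun x => ?_)
  rw [Real.norm_of_nonneg (Real.rpow_nonneg (abs_nonneg _) _)]
  have : |A η x| ^ r = |A η x| ^ (r - 1) * |A η x| := by
    rw [← Real.rpow_add_one' (abs_nonneg _) (by linarith), sub_add_cancel]
  rw [this]
  exact mul_le_mul_of_nonneg_right
    (Real.rpow_le_rpow (abs_nonneg _) (hη.abs_A_le hK x) (by linarith)) (abs_nonneg _)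

theorem A_add_const_mul (hK : 1 ≤ K) (h : MemLpCell K 2 W) (hη : MemLpCell K 2 η) (s x : ℝ) :
    A (fun y => W y + s * η y) x = A W x + s * A η x := by
  rw [A_add (h.locallyIntegrable hK) ((hη.const_mul s).locallyIntegrable hK), A_const_mul]

theorem add_const_mul_mem_X (hK : 1 ≤ K) (h : W ∈ X p q K)
    (hη : η ∈ X p q K) (s : ℝ) : (fun x => W x + s * η x) ∈ X p q K := by
  have := funext (A_add_const_mul hK h.1 hη.1 s)
  refine ⟨h.1.add (hη.1.const_mul s), ?_, ?_⟩ <;> rw [this]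
  exacts [h.2.1.add (hη.2.1.const_mul s), h.2.2.add (hη.2.2.const_mul s)]

/-- Differentiation under the integral: `A W` and `A η` are bounded, so for `|s| < 1` the derivative
is dominated by a multiple of `|A η|`. -/
theorem hasDerivAt_potential {r : ℝ} (hr : 1 < r) (hK : 1 ≤ K) (h : MemLpCell K 2 W)
    (hW : IntegrableOn (fun x => |A W x| ^ r) (cell K)) (hη : MemLpCell K 2 η)
    (hi : IntegrableOn (A η) (cell K)) :
    HasDerivAt (fun s : ℝ => potential r K (fun x => W x + s * η x))
      (∫ x in cell K, Psi r (A W x) * A η x) 0 := by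
  have hc : ∀ s, Continuous fun x => A W x + s * A η x := fun s =>
    (h.continuous_A hK).add (continuous_const.mul (hη.continuous_A hK))
  have key := hasDerivAt_integral_of_dominated_loc_of_deriv_le
    (μ := volume.restrict (cell K)) (F := fun (s x : ℝ) => |A W x + s * A η x| ^ r)
    (F' := fun (s x : ℝ) => Psi r (A W x + s * A η x) * A η x) (x₀ := (0 : ℝ))
    (s := Metric.ball 0 1)
    (bound := fun x => r * (√(normSq K W) + √(normSq K η)) ^ (r - 1) * |A η x|)
    (Metric.ball_mem_nhds _ one_pos)
    (Eventually.of_forall fun s =>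
      ((hc s).abs.rpow_const fun _ => Or.inr (by linarith)).aestronglyMeasurable)
    (by simpa [IntegrableOn] using hW)
    (((continuous_Psi hr).comp (hc 0)).mul (hη.continuous_A hK)).aestronglyMeasurable
    (Eventually.of_forall fun x s hs => ?_) (hi.norm.const_mul _)
    (Eventually.of_forall fun x s hs => ?_)
  · have := key.2
    simpa only [potential, A_add_const_mul hK h hη, zero_mul, add_zero] using this
  · rw [norm_mul, Real.norm_eq_abs, Real.norm_eq_abs]
    refine mul_le_mul_of_nonneg_right (abs_Psi_le hr ?_) (abs_nonneg _)
    rw [Metric.mem_ball, dist_zero_right, Real.norm_eq_abs] at hs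
    calc |A W x + s * A η x| ≤ |A W x| + |s * A η x| := abs_add_le _ _
      _ ≤ _ := by
        refine add_le_add (h.abs_A_le hK x) ?_
        rw [abs_mul]
        exact (mul_le_of_le_one_left (abs_nonneg _) hs.le).trans (hη.abs_A_le hK x)
  · have h1 : HasDerivAt (fun s : ℝ => A W x + s * A η x) (A η x) s := by
      simpa using ((hasDerivAt_id s).mul_const (A η x)).const_add (A W x)
    exact (hasDerivAt_abs_rpow_Psi hr _).comp s h1

/-- The perturbation `W + s η` is rescaled by `t s` back to the manifold. Minimality makes its
action at least that of `W`, which by `fibre_le` is at least that of `t s * W`. Dividing the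
difference by `s > 0` and letting `s → 0` requires only `t s → 1`; differentiability of `t` is not
needed. -/
theorem firstVariation_nonneg (hσ : 0 < σ ^ 2) (hp : 2 < p) (hq : 1 < q) (hqp : q < p)
    (hK : 1 ≤ K) (hW : W ∈ nehari σ p q K)
    (hmin : IsMinOn (action σ p q K) (nehari σ p q K) W) (hη : MemLpCell K 2 η)
    (hi : IntegrableOn (A η) (cell K)) :
    0 ≤ σ ^ 2 * (∫ x in cell K, W x * η x)
      + (∫ x in cell K, Psi q (A W x) * A η x) - ∫ x in cell K, Psi p (A W x) * A η x := by
  have hp1 : 1 < p := by linarith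
  have hηX : η ∈ X p q K := (mem_X_iff hp hq hK).2
    ⟨hη, integrableOn_abs_A_rpow_of_integrableOn hq hK hη hi⟩
  have hWL := hW.1.1
  have dQ := hasDerivAt_potential hq hK hWL
    (X.integrableOn_potential (by linarith) hK hWL hW.1.2.1) hη hi
  have dP := hasDerivAt_potential hp1 hK hWL
    (X.integrableOn_potential (by linarith) hK hWL hW.1.2.2) hη hi
  set Q : ℝ → ℝ := fun s => potential q K (fun x => W x + s * η x) with hQdef
  set P : ℝ → ℝ := fun s => potential p K (fun x => W x + s * η x) with hPdef
  set N : ℝ → ℝ := fun s => normSq K (fun x => W x + s * η x) with hNdef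
  set I := ∫ x in cell K, W x * η x with hI
  have hN : ∀ s, N s = normSq K W + 2 * s * I + s ^ 2 * normSq K η := fun s =>
    normSq_add hWL hη s
  have hN0 : N 0 = normSq K W := by simp [hN]
  have hQ0 : Q 0 = potential q K W := by simp [hQdef]
  have hP0 : P 0 = potential p K W := by simp [hPdef]
  have le0 : 𝓝[>] (0 : ℝ) ≤ 𝓝 0 := nhdsWithin_le_nhds
  have tQ : Tendsto Q (𝓝[>] 0) (𝓝 (Q 0)) := dQ.continuousAt.tendsto.mono_left le0
  have tP : Tendsto P (𝓝[>] 0) (𝓝 (P 0)) := dP.continuousAt.tendsto.mono_left le0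
  have tN : Tendsto N (𝓝[>] 0) (𝓝 (N 0)) := by
    have : Continuous N := by
      rw [show N = _ from funext hN]; fun_prop
    exact (this.tendsto 0).mono_left le0
  have hPpos : 0 < P 0 := hP0 ▸ nehari.potential_pos hσ hp hq hK hW
  -- Where the `p`-potential is not positive, the value of `t` is a dummy; this does not happen for
  -- small `s > 0`.
  have hex : ∀ s, ∃ t : ℝ, 0 < P s → 0 < t ∧ (σ ^ 2 * N s) * t ^ 2 + q * Q s * t ^ q
      - p * P s * t ^ p = 0 ∧ (fun x => t * (W x + s * η x)) ∈ nehari σ p q K := by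
    intro s
    by_cases h : 0 < P s
    · obtain ⟨t, ht⟩ := exists_const_mul_mem_nehari hσ hp hq hqp hK
        (add_const_mul_mem_X hK hW.1 hηX s) h
      exact ⟨t, fun _ => ht⟩
    · exact ⟨0, fun h' => absurd h' h⟩
  choose t ht using hex
  have hev : ∀ᶠ s in 𝓝[>] (0 : ℝ), 0 < P s := tP.eventually_const_lt hPpos
  have hroot : σ ^ 2 * N 0 + q * Q 0 - p * P 0 = 0 := by
    rw [hN0, hQ0, hP0]; exact hW.2.2
  have hNpos : 0 < σ ^ 2 * N 0 := mul_pos hσ (hN0 ▸ hWL.normSq_pos hK hW.2.1)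
  have tt : Tendsto t (𝓝[>] 0) (𝓝 1) :=
    tendsto_fibre_root hp hq hqp hNpos (potential_nonneg _ _ _) hroot (tN.const_mul _) tQ tP
      (fun s => mul_nonneg hσ.le (normSq_nonneg _ _)) (fun s => potential_nonneg _ _ _)
      (hev.mono fun s hs => ⟨(ht s hs).1, (ht s hs).2.1⟩)
  have hineq : ∀ᶠ s in 𝓝[>] (0 : ℝ), 0 ≤ 1 / 2 * σ ^ 2 * t s ^ 2 * (2 * I + s * normSq K η)
      + t s ^ q * (s⁻¹ • (Q (0 + s) - Q 0)) - t s ^ p * (s⁻¹ • (P (0 + s) - P 0)) := by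
    filter_upwards [hev, self_mem_nhdsWithin] with s hs hs0
    have hs0 : 0 < s := hs0
    obtain ⟨h1, -, h3⟩ := ht s hs
    have a1 : action σ p q K W ≤ action σ p q K (fun x => t s * (W x + s * η x)) := hmin h3
    have a2 := fibre_le hp hq hqp hNpos.le (potential_nonneg q K _) hroot h1.le
    rw [action_const_mul _ _ _ _ h1.le, action, ← hN0, ← hQ0, ← hP0] at a1
    have a3 : 0 ≤ 1 / 2 * σ ^ 2 * t s ^ 2 * (N s - N 0) + t s ^ q * (Q s - Q 0)
        - t s ^ p * (P s - P 0) := by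
      simp only [hNdef, hQdef, hPdef] at a1 a2 ⊢
      linarith
    have a4 : N s - N 0 = s * (2 * I + s * normSq K η) := by rw [hN0, hN]; ring
    rw [a4] at a3
    have a5 := mul_nonneg (inv_nonneg.2 hs0.le) a3
    have e : s⁻¹ * s = 1 := inv_mul_cancel₀ hs0.ne'
    simp only [smul_eq_mul, zero_add]
    calc (0 : ℝ) ≤ _ := a5
      _ = _ := by
        linear_combination (1 / 2 * σ ^ 2 * t s ^ 2 * (2 * I + s * normSq K η)) * e
  have hlim : Tendsto (fun s => 1 / 2 * σ ^ 2 * t s ^ 2 * (2 * I + s * normSq K η)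
      + t s ^ q * (s⁻¹ • (Q (0 + s) - Q 0)) - t s ^ p * (s⁻¹ • (P (0 + s) - P 0))) (𝓝[>] 0)
      (𝓝 (1 / 2 * σ ^ 2 * 1 ^ 2 * (2 * I + 0 * normSq K η)
        + 1 ^ q * (∫ x in cell K, Psi q (A W x) * A η x)
        - 1 ^ p * ∫ x in cell K, Psi p (A W x) * A η x)) := by
    have tid : Tendsto (fun s : ℝ => s) (𝓝[>] 0) (𝓝 0) := le0
    refine ((((tt.pow 2).const_mul _).mul ((tid.mul_const _).const_add _)).add ?_).sub ?_
    · exact (tt.rpow_const (Or.inl one_ne_zero)).mul dQ.tendsto_slope_zero_right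
    · exact (tt.rpow_const (Or.inl one_ne_zero)).mul dP.tendsto_slope_zero_right
  have := ge_of_tendsto hlim hineq
  simp only [Real.one_rpow, one_pow, zero_mul, add_zero, one_mul, mul_one] at this
  linarith

/-- The one-sided inequality is applied to `η` and to `-η`. -/
theorem integral_gradAction_mul_eq_zero (hσ : 0 < σ ^ 2) (hp : 2 < p) (hq : 1 < q) (hqp : q < p)
    (hK : 1 ≤ K) (hW : W ∈ nehari σ p q K)
    (hmin : IsMinOn (action σ p q K) (nehari σ p q K) W) (hη : MemLpCell K 2 η)
    (hi : IntegrableOn η (cell K)) : ∫ x in cell K, gradAction σ p q W x * η x = 0 := by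
  have key : ∀ {ζ : ℝ → ℝ}, MemLpCell K 2 ζ → IntegrableOn ζ (cell K) →
      0 ≤ ∫ x in cell K, gradAction σ p q W x * ζ x := by
    intro ζ hζ hiζ
    rw [integral_gradAction_mul hp hq hK hW.1.1 hζ hiζ]
    exact firstVariation_nonneg hσ hp hq hqp hK hW hmin hζ (integrableOn_A hK hζ.perOn hiζ)
  have h1 := key hη hi
  have h2 := key (hη.const_mul (-1)) (hi.const_mul (-1))
  have e : ∀ x, gradAction σ p q W x * (-1 * η x) = -1 * (gradAction σ p q W x * η x) :=
    fun x => by ring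
  simp only [e, integral_const_mul] at h2
  linarith

theorem gradAction_eq (W : ℝ → ℝ) : gradAction σ p q W = fun x => σ ^ 2 * W x
    + (A (fun s => Psi q (A W s)) x - A (fun s => Psi p (A W s)) x) := by
  ext x; rw [gradAction]; ring

theorem PerOn.gradAction (h : PerOn K W) : PerOn K (gradAction σ p q W) := by
  rw [gradAction_eq]
  exact (h.comp (fun y => σ ^ 2 * y)).comp₂
    ((h.A.comp (Psi q)).A.comp₂ (h.A.comp (Psi p)).A (fun a b => a - b)) (fun a b => a + b)

/-- Minimizers on the Nehari manifold solve the Euler–Lagrange equation. -/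
theorem gradAction_ae_eq_zero_of_isMinOn (hσ : 0 < σ ^ 2) (hp : 2 < p) (hq : 1 < q)
    (hqp : q < p) (hK : 1 ≤ K) (hW : W ∈ nehari σ p q K)
    (hmin : IsMinOn (action σ p q K) (nehari σ p q K) W) : gradAction σ p q W =ᵐ[volume] 0 := by
  have hp1 : 1 < p := by linarith
  set G := gradAction σ p q W with hG
  have hcont : Continuous fun x => A (fun s => Psi q (A W s)) x - A (fun s => Psi p (A W s)) x :=
    (continuous_A (hW.1.1.continuous_Psi_A hq hK).locallyIntegrable).sub
      (continuous_A (hW.1.1.continuous_Psi_A hp1 hK).locallyIntegrable)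
  have hloc : ∀ a b : ℝ, volume.restrict (Set.Icc a b) ≤ volume.restrict (cell K) →
      MemLp G 2 (volume.restrict (Set.Icc a b)) := by
    intro a b hab
    rw [hG, gradAction_eq]
    refine ((hW.1.1.memLp_two.mono_measure hab).const_mul _).add ?_
    exact memLp_Icc_of_continuous hcont a b 2
  have hper : PerOn K G := hW.1.1.perOn.gradAction
  obtain rfl | ⟨k, hk, rfl⟩ := eq_top_or_exists_coe hK
  -- On the line the gradient need not a priori be an admissible test function, so it is tested
  -- against its own restriction to `[-R, R]`. On a bounded cell it can be tested against itself
  -- directly.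
  · have hR : ∀ R : ℕ, ∀ᵐ x ∂volume.restrict (Set.Icc (-R : ℝ) R), G x = 0 := by
      intro R
      have hL := hloc (-R) R (by rw [cell_top]; exact Measure.restrict_mono (Set.subset_univ _) le_rfl)
      have hη2 : MemLp ((Set.Icc (-R : ℝ) R).indicator G) 2 volume :=
        (memLp_indicator_iff_restrict measurableSet_Icc).2 hL
      have hη : MemLpCell ⊤ 2 ((Set.Icc (-R : ℝ) R).indicator G) :=
        ⟨perOn_top _, by simpa [cell_top] using hη2⟩
      have hi : IntegrableOn ((Set.Icc (-R : ℝ) R).indicator G) (cell ⊤) := by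
        rw [cell_top, integrableOn_univ]
        exact (integrable_indicator_iff measurableSet_Icc).2 (hL.integrable (by norm_num))
      have h0 := integral_gradAction_mul_eq_zero hσ hp hq hqp hK hW hmin hη hi
      rw [← hG, cell_top, Measure.restrict_univ] at h0
      have e : (fun x => G x * (Set.Icc (-R : ℝ) R).indicator G x)
          = (Set.Icc (-R : ℝ) R).indicator (fun x => G x ^ 2) := by
        ext x
        by_cases hx : x ∈ Set.Icc (-R : ℝ) R <;> simp [hx, sq]
      rw [e, integral_indicator measurableSet_Icc,
        integral_eq_zero_iff_of_nonneg (fun _ => sq_nonneg _) hL.integrable_sq] at h0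
      exact h0.mono fun x hx => by simpa using hx
    have := (ae_restrict_iUnion_iff (μ := volume) (fun R : ℕ => Set.Icc (-R : ℝ) R)
      (fun x => G x = 0)).2 hR
    have hU : ⋃ R : ℕ, Set.Icc (-R : ℝ) R = Set.univ := by
      refine Set.eq_univ_of_forall fun x => Set.mem_iUnion.2 ?_
      obtain ⟨n, hn⟩ := exists_nat_ge |x|
      exact ⟨n, abs_le.1 hn⟩
    rw [hU, Measure.restrict_univ] at this
    exact this
  · have hL : MemLpCell k 2 G := by
      refine ⟨hper, ?_⟩
      rw [hG, gradAction_eq]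
      refine (hW.1.1.2.const_mul _).add ?_
      rw [cell_coe]
      simpa using (memLp_Icc_of_continuous hcont (-k) k 2).mono_measure
          (Measure.restrict_mono Set.Ioc_subset_Icc_self le_rfl)
    have hi : IntegrableOn G (cell k) :=
      (hL.locallyIntegrable hK).integrableOn_isCompact (isCompact_Icc (a := -k) (b := k))
        |>.mono_set (by rw [cell_coe]; exact Set.Ioc_subset_Icc_self)
    have h0 := integral_gradAction_mul_eq_zero hσ hp hq hqp hK hW hmin hL hi
    refine hL.ae_eq_zero hK ?_
    simpa only [normSq, sq] using h0

end EulerLagrange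

/-! ### Truncation of functions on the line -/

section Truncation

variable {σ p q : ℝ} {W : ℝ → ℝ}

theorem memLpCell_top {r : ℝ} : MemLpCell ⊤ r W ↔ MemLp W (ENNReal.ofReal r) volume := by
  simp [MemLpCell, cell_top]

theorem normSq_top (W : ℝ → ℝ) : normSq ⊤ W = ∫ x, W x ^ 2 := by
  simp [normSq, cell_top]

theorem potential_top (r : ℝ) (W : ℝ → ℝ) : potential r ⊤ W = ∫ x, |A W x| ^ r := by
  simp [potential, cell_top]

theorem MemLpCell.indicator_top (h : MemLpCell ⊤ 2 W) {S : Set ℝ} (hS : MeasurableSet S) :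
    MemLpCell ⊤ 2 (S.indicator W) :=
  memLpCell_top.2 ((memLpCell_top.1 h).indicator hS)

/-- Functions that are both integrable and square-integrable belong to `X_∞`. -/
theorem mem_X_top_of_integrable (hp : 2 < p) (hq : 1 < q) (h : MemLpCell ⊤ 2 W)
    (hi : Integrable W) : W ∈ X p q ⊤ := by
  have hK : (1 : EReal) ≤ ⊤ := le_top
  refine (mem_X_iff hp hq hK).2 ⟨h, integrableOn_abs_A_rpow_of_integrableOn hq hK h ?_⟩
  exact integrableOn_A hK h.perOn (by rwa [cell_top, integrableOn_univ])

theorem indicator_sq (S : Set ℝ) (W : ℝ → ℝ) :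
    (fun x => S.indicator W x ^ 2) = S.indicator (fun x => W x ^ 2) := by
  ext x
  by_cases hx : x ∈ S <;> simp [hx]

theorem tendsto_integral_Icc {f : ℝ → ℝ} (hf : Integrable f) (c : ℝ) :
    Tendsto (fun n : ℕ => ∫ x in Set.Icc (-(n + c) : ℝ) (n + c), f x) atTop (𝓝 (∫ x, f x)) := by
  have h1 : Tendsto (fun n : ℕ => (n + c : ℝ)) atTop atTop :=
    tendsto_atTop_add_const_right _ c tendsto_natCast_atTop_atTop
  exact (aecover_Icc (tendsto_neg_atTop_atBot.comp h1) h1).integral_tendsto_of_countably_generated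
    hf

/-- The square root of the mass outside of `[-(n - 1), n - 1]`. -/
noncomputable def tail (W : ℝ → ℝ) (n : ℕ) : ℝ :=
  √(∫ x in (Set.Icc (-(n + -1) : ℝ) (n + -1))ᶜ, W x ^ 2)

theorem tendsto_tail (h : MemLpCell ⊤ 2 W) : Tendsto (tail W) atTop (𝓝 0) := by
  have hi : Integrable (fun x => W x ^ 2) := by
    simpa [cell_top] using h.integrableOn_sq
  have h1 := (tendsto_const_nhds (x := ∫ x, W x ^ 2)).sub (tendsto_integral_Icc hi (-1))
  have h2 : ∀ n : ℕ, (∫ x in (Set.Icc (-(n + -1) : ℝ) (n + -1))ᶜ, W x ^ 2)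
      = (∫ x, W x ^ 2) - ∫ x in Set.Icc (-(n + -1) : ℝ) (n + -1), W x ^ 2 := fun n => by
    rw [← integral_add_compl (measurableSet_Icc (a := (-(n + -1) : ℝ)) (b := n + -1)) hi]; ring
  have h3 := h1.sqrt
  simp only [sub_self, Real.sqrt_zero] at h3
  refine h3.congr fun n => ?_
  rw [tail, h2]

variable {n : ℕ} {x : ℝ}

theorem A_indicator_inner (hx : |x| ≤ n - 1 / 2) :
    A ((Set.Icc (-n : ℝ) n).indicator W) x = A W x := by
  rw [abs_le] at hx
  refine intervalIntegral.integral_congr fun s hs => ?_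
  rw [Set.uIcc_of_le (by linarith)] at hs
  have : s ∈ Set.Icc (-n : ℝ) n := ⟨by linarith [hs.1], by linarith [hs.2]⟩
  exact Set.indicator_of_mem this _

theorem A_indicator_outer (hx : n + 1 / 2 < |x|) :
    A ((Set.Icc (-n : ℝ) n).indicator W) x = 0 := by
  rw [lt_abs] at hx
  rw [A, intervalIntegral.integral_congr (g := fun _ => (0 : ℝ)), intervalIntegral.integral_zero]
  intro s hs
  rw [Set.uIcc_of_le (by linarith)] at hs
  refine Set.indicator_of_notMem (fun h => ?_) _
  rcases hx with hx | hx <;> linarith [hs.1, hs.2, h.1, h.2]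

/-- The unit window around `x` misses `[-(n - 1), n - 1]`, which explains the radius in `tail`. -/
theorem abs_A_indicator_le (h : MemLpCell ⊤ 2 W) (hx : n - 1 / 2 < |x|) :
    |A ((Set.Icc (-n : ℝ) n).indicator W) x| ≤ tail W n := by
  have hK : (1 : EReal) ≤ ⊤ := le_top
  have h' := h.indicator_top (S := Set.Icc (-n : ℝ) n) measurableSet_Icc
  have hi : Integrable (fun x => W x ^ 2) := by
    simpa [cell_top] using h.integrableOn_sq
  refine Real.abs_le_sqrt ((h'.sq_A_le hK x).trans ?_)
  refine (A_mono (h'.locallyIntegrable_sq hK) (h.locallyIntegrable_sq hK) (fun y => ?_) x).trans ?_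
  · rw [show Set.indicator _ W y ^ 2 = _ from congrFun (indicator_sq _ W) y]
    exact Set.indicator_le_self' (fun _ _ => sq_nonneg _) y
  · rw [A, intervalIntegral.integral_of_le (by linarith), ← integral_Icc_eq_integral_Ioc,
      integral_Icc_eq_integral_Ioo]
    refine setIntegral_mono_set hi.integrableOn (Eventually.of_forall fun _ => sq_nonneg _)
      (LE.le.eventuallyLE ?_)
    intro s hs hs2
    rw [lt_abs] at hx
    rcases hx with hx | hx <;> linarith [hs.1, hs.2, hs2.1, hs2.2]

/-- Convergence of integrals that differ only by vanishing contributions near `±n`. -/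
theorem tendsto_integral_of_edge {h : ℝ → ℝ} (hi : Integrable h) {g : ℕ → ℝ → ℝ}
    (hgi : ∀ n, Integrable (g n)) (inner : ∀ (n : ℕ) (x : ℝ), |x| ≤ n - 1 / 2 → g n x = h x)
    (outer : ∀ (n : ℕ) (x : ℝ), n + 1 / 2 < |x| → g n x = 0) {e : ℕ → ℝ} (he : Tendsto e atTop (𝓝 0))
    (edge : ∀ (n : ℕ) (x : ℝ), n - 1 / 2 < |x| → |g n x| ≤ e n) :
    Tendsto (fun n => ∫ x, g n x) atTop (𝓝 (∫ x, h x)) := by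
  set S : ℕ → Set ℝ := fun n => Set.Icc (-(n + -(1 / 2)) : ℝ) (n + -(1 / 2)) with hS
  -- Two unit bands around `±n`, of total length at most 2; off them `g n` either equals `h` or
  -- vanishes.
  set E : ℕ → Set ℝ := fun n => (Set.Icc (-(n + 1 / 2) : ℝ) (-(n - 1 / 2))) ∪
    Set.Icc (n - 1 / 2 : ℝ) (n + 1 / 2) with hE
  have memS : ∀ n x, x ∈ S n ↔ |x| ≤ n - 1 / 2 := fun n x => by
    rw [abs_le]; simp only [hS, Set.mem_Icc, sub_eq_add_neg]
  have hvol : ∀ n, volume (E n) ≤ 2 := fun n => by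
    refine (measure_union_le _ _).trans ?_
    rw [Real.volume_Icc, Real.volume_Icc, ← ENNReal.ofReal_add (by linarith) (by linarith)]
    refine ENNReal.ofReal_le_of_le_toReal ?_
    norm_num
    linarith
  have hlt : ∀ n, volume (E n \ S n) ≤ 2 := fun n => (measure_mono Set.sdiff_subset).trans (hvol n)
  have split : ∀ n, ∫ x, g n x = (∫ x in S n, h x) + ∫ x in E n \ S n, g n x := fun n => by
    rw [← integral_add_compl (measurableSet_Icc (a := (-(n + -(1 / 2)) : ℝ)) (b := n + -(1 / 2)))
      (hgi n)]
    congr 1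
    · exact setIntegral_congr_fun measurableSet_Icc fun x hx => inner n x ((memS n x).1 hx)
    · refine setIntegral_eq_of_subset_of_forall_sdiff_eq_zero (s := E n \ S n) (t := (S n)ᶜ)
        measurableSet_Icc.compl (fun x hx => hx.2) fun x hx => outer n x ?_
      have h1 : ¬ |x| ≤ n - 1 / 2 := fun h => hx.1 ((memS n x).2 h)
      by_contra! h2
      refine hx.2 ⟨?_, hx.1⟩
      push Not at h1
      rw [abs_le] at h2
      rw [lt_abs] at h1
      rcases h1 with h1 | h1
      · exact Or.inr ⟨by linarith, h2.2⟩
      · exact Or.inl ⟨by linarith, by linarith⟩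
  have small : Tendsto (fun n => ∫ x in E n \ S n, g n x) atTop (𝓝 0) := by
    refine squeeze_zero_norm (a := fun n => |e n| * 2) (fun n => ?_) ?_
    · refine (norm_setIntegral_le_of_norm_le_const ((hlt n).trans_lt (by norm_num))
        (C := |e n|) fun x hx => ?_).trans ?_
      · exact (edge n x (by
          by_contra! h2
          exact hx.2 ((memS n x).2 h2))).trans (le_abs_self _)
      · refine mul_le_mul_of_nonneg_left ?_ (abs_nonneg _)
        exact ENNReal.toReal_le_of_le_ofReal (by norm_num) (by simpa using hlt n)
    · simpa using he.abs.mul_const 2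
  have := (tendsto_integral_Icc hi (-(1 / 2))).add small
  rw [add_zero] at this
  exact this.congr fun n => (split n).symm

theorem integrable_indicator_Icc (h : MemLpCell ⊤ 2 W) (a b : ℝ) :
    Integrable ((Set.Icc a b).indicator W) := by
  rw [integrable_indicator_iff measurableSet_Icc]
  exact (h.locallyIntegrable le_top).integrableOn_isCompact isCompact_Icc

theorem tendsto_normSq_indicator (h : MemLpCell ⊤ 2 W) :
    Tendsto (fun n : ℕ => normSq ⊤ ((Set.Icc (-n : ℝ) n).indicator W)) atTop
      (𝓝 (normSq ⊤ W)) := by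
  have hi : Integrable (fun x => W x ^ 2) := by
    simpa [cell_top] using h.integrableOn_sq
  have := tendsto_integral_Icc hi 0
  simp only [normSq_top, indicator_sq, integral_indicator measurableSet_Icc]
  simpa using this

/-- Truncation alters `A W` inside `[-(n + 1/2), n + 1/2]` only near `±n`, where the truncated
average is bounded by the `L²` tail. This also covers exponents `r < 2`, which are not controlled by
`L²` convergence. -/
theorem tendsto_potential_indicator {r : ℝ} (hr : 1 < r) (h : MemLpCell ⊤ 2 W)
    (hW : Integrable (fun x => |A W x| ^ r)) :
    Tendsto (fun n : ℕ => potential r ⊤ ((Set.Icc (-n : ℝ) n).indicator W)) atTop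
      (𝓝 (potential r ⊤ W)) := by
  have hK : (1 : EReal) ≤ ⊤ := le_top
  simp only [potential_top]
  refine tendsto_integral_of_edge hW (e := fun n => tail W n ^ r) (fun n => ?_) ?_ ?_ ?_ ?_
  · have h' := h.indicator_top (S := Set.Icc (-n : ℝ) n) measurableSet_Icc
    have := integrableOn_abs_A_rpow_of_integrableOn hr hK h' (integrableOn_A hK h'.perOn
      (by rw [cell_top, integrableOn_univ]; exact integrable_indicator_Icc h _ _))
    rwa [cell_top, integrableOn_univ] at this
  · intro n x hx
    rw [A_indicator_inner hx]
  · intro n x hx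
    rw [A_indicator_outer hx, abs_zero, Real.zero_rpow (by linarith)]
  · have := (tendsto_tail h).rpow_const (p := r) (Or.inr (by linarith))
    rwa [Real.zero_rpow (by linarith)] at this
  · intro n x hx
    rw [abs_of_nonneg (Real.rpow_nonneg (abs_nonneg _) _)]
    exact Real.rpow_le_rpow (abs_nonneg _) (abs_A_indicator_le h hx) (by linarith)

/-- Needed to test the equation with `W` itself on the line: `W` need not be integrable, but its
truncations are. -/
theorem tendsto_integral_Psi_mul_A_indicator {r : ℝ} (hr : 1 < r) (h : MemLpCell ⊤ 2 W)
    (hW : Integrable (fun x => |A W x| ^ r)) :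
    Tendsto (fun n : ℕ => ∫ x, Psi r (A W x) * A ((Set.Icc (-n : ℝ) n).indicator W) x) atTop
      (𝓝 (r * potential r ⊤ W)) := by
  have hK : (1 : EReal) ≤ ⊤ := le_top
  have e1 : r * potential r ⊤ W = ∫ x, Psi r (A W x) * A W x := by
    simp only [Psi_mul_self hr, integral_const_mul, potential_top]
  rw [e1]
  refine tendsto_integral_of_edge (by simpa only [Psi_mul_self hr] using hW.const_mul r)
    (e := fun n => r * √(normSq ⊤ W) ^ (r - 1) * tail W n) (fun n => ?_) ?_ ?_ ?_ ?_
  · have h' := h.indicator_top (S := Set.Icc (-n : ℝ) n) measurableSet_Icc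
    have := h.integrableOn_Psi_mul hr hK (integrableOn_A hK h'.perOn
      (by rw [cell_top, integrableOn_univ]; exact integrable_indicator_Icc h _ _))
    rwa [cell_top, integrableOn_univ] at this
  · intro n x hx
    rw [A_indicator_inner hx]
  · intro n x hx
    rw [A_indicator_outer hx, mul_zero]
  · simpa using (tendsto_tail h).const_mul (r * √(normSq ⊤ W) ^ (r - 1))
  · intro n x hx
    rw [abs_mul]
    exact mul_le_mul (h.abs_Psi_A_le hr hK x) (abs_A_indicator_le h hx) (abs_nonneg _)
      (by positivity)

end Truncation

/-! ### Travelling waves lie on the Nehari manifold -/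

section TravellingWaves

variable {σ p q : ℝ} {K : EReal} {W : ℝ → ℝ}

/-- Testing the equation with `W` yields the Nehari identity, since `Psi r w * w = r * |w| ^ r`. On
the line the test functions are truncations of `W`, followed by a limit. -/
theorem travellingWaves_subset_nehari (hp : 2 < p) (hq : 1 < q) (hK : 1 ≤ K) :
    travellingWaves σ p q K ⊆ nehari σ p q K := by
  rintro W ⟨hW, h0, hG⟩
  refine ⟨hW, h0, ?_⟩
  have hp1 : 1 < p := by linarith
  have hzero : ∀ η : ℝ → ℝ, ∫ x in cell K, gradAction σ p q W x * η x = 0 := fun η => by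
    rw [← integral_zero ℝ ℝ (μ := volume.restrict (cell K))]
    refine integral_congr_ae (ae_restrict_of_ae (hG.mono fun x hx => ?_))
    simp only [hx, Pi.zero_apply, zero_mul]
  obtain rfl | ⟨k, hk, rfl⟩ := eq_top_or_exists_coe hK
  · have iq := X.integrableOn_potential (by linarith) hK hW.1 hW.2.1
    have ip := X.integrableOn_potential (by linarith) hK hW.1 hW.2.2
    rw [cell_top, integrableOn_univ] at iq ip
    have lim := (((tendsto_normSq_indicator hW.1).const_mul (σ ^ 2)).add
      (tendsto_integral_Psi_mul_A_indicator hq hW.1 iq)).sub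
      (tendsto_integral_Psi_mul_A_indicator hp1 hW.1 ip)
    refine tendsto_nhds_unique lim (tendsto_const_nhds.congr fun n => ?_)
    have h' := hW.1.indicator_top (S := Set.Icc (-n : ℝ) n) measurableSet_Icc
    have key := integral_gradAction_mul (σ := σ) hp hq hK hW.1 h'
      (by rw [cell_top, integrableOn_univ]; exact integrable_indicator_Icc hW.1 _ _)
    rw [hzero] at key
    have e : ∀ x, W x * (Set.Icc (-n : ℝ) n).indicator W x
        = (Set.Icc (-n : ℝ) n).indicator W x ^ 2 := fun x => by
      by_cases hx : x ∈ Set.Icc (-n : ℝ) n <;> simp [hx, sq]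
    simp only [e, cell_top, Measure.restrict_univ] at key
    rw [key, normSq_top]
  · have hi : IntegrableOn W (cell k) :=
      (hW.1.locallyIntegrable hK).integrableOn_isCompact (isCompact_Icc (a := -k) (b := k))
        |>.mono_set (by rw [cell_coe]; exact Set.Ioc_subset_Icc_self)
    have key := integral_gradAction_mul (σ := σ) hp hq hK hW.1 hW.1 hi
    rw [hzero] at key
    simp only [Psi_mul_self hq, Psi_mul_self hp1, integral_const_mul, ← sq] at key
    rw [nehariFunctional, key]
    rfl

/-- Minimizers on the Nehari manifold are ground waves. -/
theorem isGroundWave_of_isMinOn (hσ : 0 < σ ^ 2) (hp : 2 < p) (hq : 1 < q) (hqp : q < p)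
    (hK : 1 ≤ K) (hW : W ∈ nehari σ p q K)
    (hmin : IsMinOn (action σ p q K) (nehari σ p q K) W) : IsGroundWave σ p q K W :=
  ⟨⟨hW.1, hW.2.1, gradAction_ae_eq_zero_of_isMinOn hσ hp hq hqp hK hW hmin⟩,
    hmin.on_subset (travellingWaves_subset_nehari hp hq hK)⟩

end TravellingWaves

/-! ### Periodization and the comparison of `ℓ_K` with `ℓ_∞` -/

section Periodize

variable {σ p q k : ℝ} {f W : ℝ → ℝ}

/-- The `2k`-periodic function that agrees with `f` on `(-k, k]`. -/
noncomputable def periodize (k : ℝ) (hk : 0 < 2 * k) (f : ℝ → ℝ) (x : ℝ) : ℝ :=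
  f (toIocMod hk (-k) x)

theorem periodize_periodic (hk : 0 < 2 * k) (f : ℝ → ℝ) :
    Function.Periodic (periodize k hk f) (2 * k) := fun x => by
  simp only [periodize, toIocMod_add_right]

theorem periodize_of_mem (hk : 0 < 2 * k) (f : ℝ → ℝ) {x : ℝ} (hx : x ∈ Set.Ioc (-k) k) :
    periodize k hk f x = f x := by
  rw [periodize, (toIocMod_eq_self hk).2]
  rwa [show -k + 2 * k = k by ring]

theorem memLpCell_periodize (hk : 0 < 2 * k) (h : MemLp f 2 (volume.restrict (Set.Ioc (-k) k))) :
    MemLpCell k 2 (periodize k hk f) := by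
  refine ⟨perOn_coe.2 (periodize_periodic hk f), ?_⟩
  rw [cell_coe]
  have e : f =ᵐ[volume.restrict (Set.Ioc (-k) k)] periodize k hk f :=
    ae_restrict_of_forall_mem measurableSet_Ioc fun x hx => (periodize_of_mem hk f hx).symm
  simpa using (memLp_congr_ae e).1 h

theorem normSq_periodize {n : ℕ} (hk : 0 < 2 * k) (hn : n + 1 ≤ k)
    (hf : ∀ x, x ∉ Set.Icc (-n : ℝ) n → f x = 0) :
    normSq k (periodize k hk f) = normSq ⊤ f := by
  rw [normSq, normSq_top, cell_coe, setIntegral_congr_fun measurableSet_Ioc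
    (g := fun x => f x ^ 2) fun x hx => by simp only [periodize_of_mem hk f hx]]
  refine setIntegral_eq_integral_of_forall_compl_eq_zero fun x hx => ?_
  rw [hf x fun h => hx ⟨by linarith [h.1], by linarith [h.2]⟩]; simp

/-- A window centred in the cell reaches at most `1/2` beyond it. With the margin `n + 1 ≤ k`, both
`f` and its neighbouring copies vanish there. -/
theorem A_periodize {n : ℕ} (hk : 0 < 2 * k) (hn : n + 1 ≤ k)
    (hf : ∀ x, x ∉ Set.Icc (-n : ℝ) n → f x = 0) {x : ℝ} (hx : x ∈ Set.Ioc (-k) k) :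
    A (periodize k hk f) x = A f x := by
  have hper := periodize_periodic hk f
  refine intervalIntegral.integral_congr fun s hs => ?_
  rw [Set.uIcc_of_le (by linarith)] at hs
  have hn0 : (0 : ℝ) ≤ n := n.cast_nonneg
  obtain ⟨h1, h2⟩ := hs
  obtain ⟨h3, h4⟩ := hx
  rcases le_or_gt s (-k) with h5 | h5
  · rw [← hper s, periodize_of_mem hk f ⟨by linarith, by linarith⟩,
      hf _ fun h => by linarith [h.2], hf _ fun h => by linarith [h.1]]
  · rcases le_or_gt s k with h6 | h6
    · exact periodize_of_mem hk f ⟨h5, h6⟩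
    · rw [← hper.sub_eq s, periodize_of_mem hk f ⟨by linarith, by linarith⟩,
        hf _ fun h => by linarith [h.1], hf _ fun h => by linarith [h.2]]

theorem potential_periodize {r : ℝ} (hr : 0 < r) {n : ℕ} (hk : 0 < 2 * k) (hn : n + 1 ≤ k)
    (hf : ∀ x, x ∉ Set.Icc (-n : ℝ) n → f x = 0) :
    potential r k (periodize k hk f) = potential r ⊤ f := by
  rw [potential, potential_top, cell_coe, setIntegral_congr_fun measurableSet_Ioc
    (g := fun x => |A f x| ^ r) fun x hx => by simp only [A_periodize hk hn hf hx]]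
  refine setIntegral_eq_integral_of_forall_compl_eq_zero fun x hx => ?_
  have hn0 : (0 : ℝ) ≤ n := n.cast_nonneg
  have e : f = (Set.Icc (-n : ℝ) n).indicator f := by
    ext y
    by_cases hy : y ∈ Set.Icc (-n : ℝ) n <;> simp only [hy, Set.indicator_of_mem,
      Set.indicator_of_notMem, not_false_eq_true, hf]
  rw [e, A_indicator_outer, abs_zero, Real.zero_rpow hr.ne']
  rw [lt_abs]
  by_contra! h
  exact hx ⟨by linarith [h.2], by linarith [h.1]⟩

/-- The upper bound `limsup ℓ_K ≤ ℓ_∞`. -/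
theorem eventually_ell_lt (hσ : 0 < σ ^ 2) (hp : 2 < p) (hq : 1 < q) (hqp : q < p)
    (hW : W ∈ nehari σ p q ⊤) {b : ℝ} (hb : action σ p q ⊤ W < b) :
    ∀ᶠ k : ℝ in atTop, ell σ p q (k : EReal) < b := by
  have hK : (1 : EReal) ≤ ⊤ := le_top
  have iq := X.integrableOn_potential (by linarith) hK hW.1.1 hW.1.2.1
  have ip := X.integrableOn_potential (by linarith) hK hW.1.1 hW.1.2.2
  rw [cell_top, integrableOn_univ] at iq ip
  set T : ℕ → ℝ → ℝ := fun n => (Set.Icc (-n : ℝ) n).indicator W with hT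
  have tN : Tendsto (fun n => σ ^ 2 * normSq ⊤ (T n)) atTop (𝓝 (σ ^ 2 * normSq ⊤ W)) :=
    (tendsto_normSq_indicator hW.1.1).const_mul _
  have tQ : Tendsto (fun n => potential q ⊤ (T n)) atTop (𝓝 (potential q ⊤ W)) :=
    tendsto_potential_indicator hq hW.1.1 iq
  have tP : Tendsto (fun n => potential p ⊤ (T n)) atTop (𝓝 (potential p ⊤ W)) :=
    tendsto_potential_indicator (by linarith) hW.1.1 ip
  have hTX : ∀ n, T n ∈ X p q ⊤ := fun n => mem_X_top_of_integrable hp hq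
    (hW.1.1.indicator_top measurableSet_Icc) (integrable_indicator_Icc hW.1.1 _ _)
  have hex : ∀ n, ∃ t : ℝ, 0 < potential p ⊤ (T n) → 0 < t ∧
      (σ ^ 2 * normSq ⊤ (T n)) * t ^ 2 + q * potential q ⊤ (T n) * t ^ q
      - p * potential p ⊤ (T n) * t ^ p = 0 := by
    intro n
    by_cases h : 0 < potential p ⊤ (T n)
    · obtain ⟨t, ht, ht2, -⟩ := exists_const_mul_mem_nehari hσ hp hq hqp hK (hTX n) h
      exact ⟨t, fun _ => ⟨ht, ht2⟩⟩
    · exact ⟨0, fun h' => absurd h' h⟩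
  choose t ht using hex
  have hev : ∀ᶠ n in atTop, 0 < potential p ⊤ (T n) :=
    tP.eventually_const_lt (nehari.potential_pos hσ hp hq hK hW)
  have tt : Tendsto t atTop (𝓝 1) :=
    tendsto_fibre_root hp hq hqp (mul_pos hσ (hW.1.1.normSq_pos hK hW.2.1))
      (potential_nonneg _ _ _) hW.2.2 tN tQ tP
      (fun s => mul_nonneg hσ.le (normSq_nonneg _ _)) (fun s => potential_nonneg _ _ _)
      (hev.mono fun n hn => ht n hn)
  have tL : Tendsto (fun n => 1 / 2 * (σ ^ 2 * normSq ⊤ (T n)) * t n ^ 2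
      + potential q ⊤ (T n) * t n ^ q - potential p ⊤ (T n) * t n ^ p) atTop
      (𝓝 (1 / 2 * (σ ^ 2 * normSq ⊤ W) * 1 ^ 2
      + potential q ⊤ W * 1 ^ q - potential p ⊤ W * 1 ^ p)) :=
    (((tN.const_mul _).mul (tt.pow 2)).add
      (tQ.mul (tt.rpow_const (Or.inl one_ne_zero)))).sub
      (tP.mul (tt.rpow_const (Or.inl one_ne_zero)))
  have eL : 1 / 2 * (σ ^ 2 * normSq ⊤ W) * 1 ^ 2
      + potential q ⊤ W * 1 ^ q - potential p ⊤ W * 1 ^ p = action σ p q ⊤ W := by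
    simp only [Real.one_rpow, action]; ring
  rw [eL] at tL
  -- One truncation whose rescaling has action below `b` is fixed. Its periodization keeps the norm
  -- and both potentials for every `k ≥ n + 1`, so it competes on all these cells with the same
  -- action.
  obtain ⟨n, hn, hnb⟩ := (hev.and (tL.eventually_lt_const hb)).exists
  obtain ⟨ht0, hroot⟩ := ht n hn
  filter_upwards [eventually_ge_atTop ((n : ℝ) + 1)] with k hk
  have hn0 : (0 : ℝ) ≤ n := n.cast_nonneg
  have hk1 : 1 ≤ k := by linarith
  have hk2 : 0 < 2 * k := by linarith
  have hsupp : ∀ x, x ∉ Set.Icc (-n : ℝ) n → T n x = 0 := fun x hx =>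
    Set.indicator_of_notMem hx _
  have eN := normSq_periodize hk2 hk hsupp
  have eQ := potential_periodize (r := q) (by linarith) hk2 hk hsupp
  have eP := potential_periodize (r := p) (by linarith) hk2 hk hsupp
  have hX : periodize k hk2 (T n) ∈ X p q k := by
    refine mem_X_coe hp hq hk1 (memLpCell_periodize hk2 ?_)
    have : MemLp (T n) 2 volume := by simpa using memLpCell_top.1 (hTX n).1
    exact this.restrict _
  have hNpos : 0 < normSq ⊤ (T n) := by
    refine (normSq_nonneg _ _).lt_of_ne fun h0 => ?_
    have := (hTX n).1.potential_le hp.le hK (Real.sqrt_nonneg _) ((hTX n).1.abs_A_le hK)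
    rw [← h0, mul_zero] at this
    linarith
  have hmem : (fun x => t n * periodize k hk2 (T n) x) ∈ nehari σ p q k := by
    refine ⟨const_mul_mem_X hX _, not_ae_eq_zero_of_normSq_pos (K := k) ?_, ?_⟩
    · rw [normSq_const_mul, eN]; positivity
    · rw [nehariFunctional_const_mul _ _ _ _ ht0.le, eN, eQ, eP, hroot]
  refine (ell_le hp hqp hmem).trans_lt ?_
  rw [action_const_mul _ _ _ _ ht0.le, eN, eQ, eP]
  exact hnb

theorem nehari_top_nonempty (hσ : 0 < σ ^ 2) (hp : 2 < p) (hq : 1 < q) (hqp : q < p) :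
    (nehari σ p q ⊤).Nonempty := by
  have hK : (1 : EReal) ≤ ⊤ := le_top
  -- The half-width 1 exceeds the averaging radius, so `A f = 1` on `[-1/2, 1/2]` and the
  -- `p`-potential is positive.
  set f : ℝ → ℝ := (Set.Icc (-(1 : ℕ) : ℝ) (1 : ℕ)).indicator fun _ => 1 with hf
  have hL : MemLpCell ⊤ 2 f := memLpCell_top.2
    ((memLp_indicator_const _ measurableSet_Icc _ (Or.inr (by simp))))
  have hi : Integrable f :=
    (integrable_indicator_iff measurableSet_Icc).2 (by simp [integrableOn_const_iff])
  have hX : f ∈ X p q ⊤ := mem_X_top_of_integrable hp hq hL hi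
  have hA : ∀ x ∈ Set.Icc (-(1 / 2) : ℝ) (1 / 2), A f x = 1 := fun x hx => by
    rw [hf, A_indicator_inner (by rw [abs_le]; norm_num; norm_num at hx; exact hx), A_const]
  have hP : 0 < potential p ⊤ f := by
    have ip := X.integrableOn_potential (by linarith) hK hX.1 hX.2.2
    rw [cell_top, integrableOn_univ] at ip
    have h1 := setIntegral_le_integral (s := Set.Icc (-(1 / 2) : ℝ) (1 / 2)) ip
      (Eventually.of_forall fun x => Real.rpow_nonneg (abs_nonneg _) _)
    rw [setIntegral_congr_fun measurableSet_Icc (g := fun _ => (1 : ℝ))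
      fun x hx => by simp [hA x hx]] at h1
    rw [potential_top]
    refine lt_of_lt_of_le ?_ h1
    norm_num
  obtain ⟨t, -, -, h⟩ := exists_const_mul_mem_nehari hσ hp hq hqp hK hX hP
  exact ⟨_, h⟩

theorem nehari_coe_nonempty (hσ : 0 < σ ^ 2) (hp : 2 < p) (hq : 1 < q) (hqp : q < p)
    (hk : 1 ≤ k) : (nehari σ p q k).Nonempty := by
  have hK : (1 : EReal) ≤ k := by exact_mod_cast hk
  have hL : MemLpCell k 2 (fun _ => (1 : ℝ)) := by
    refine ⟨perOn_const _ _, ?_⟩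
    rw [cell_coe]
    exact memLp_const _
  have hX := mem_X_coe hp hq hk hL
  have hP : 0 < potential p k (fun _ => (1 : ℝ)) := by
    simp only [potential, A_const, cell_coe]
    simp
    linarith
  obtain ⟨t, -, -, h⟩ := exists_const_mul_mem_nehari hσ hp hq hqp hK hX hP
  exact ⟨_, h⟩

end Periodize

/-! ### Pointwise compactness -/

/-- Bounded sequences of functions with a common modulus of continuity have pointwise
convergent subsequences. -/
theorem exists_subseq_tendsto_pointwise {U : ℕ → ℝ → ℝ} {M : ℝ} (hM : ∀ n x, |U n x| ≤ M)
    (hU : ∀ n x y, x ≤ y → y ≤ x + 1 → |U n y - U n x| ≤ 2 * √(y - x) * M) :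
    ∃ φ : ℕ → ℕ, StrictMono φ ∧ ∃ u : ℝ → ℝ, ∀ x,
      Tendsto (fun n => U (φ n) x) atTop (𝓝 (u x)) := by
  -- Compactness of a countable product replaces the diagonal argument on the rationals.
  have hcomp : IsCompact (Set.univ.pi fun _ : ℚ => Set.Icc (-M) M) :=
    isCompact_univ_pi fun _ => isCompact_Icc
  obtain ⟨v, -, φ, hφ, hv⟩ := hcomp.tendsto_subseq (x := fun n (r : ℚ) => U n r)
    fun n r _ => abs_le.1 (hM n r)
  rw [tendsto_pi_nhds] at hv
  refine ⟨φ, hφ, ?_⟩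
  have hc : ∀ x, CauchySeq fun n => U (φ n) x := by
    intro x
    rw [Metric.cauchySeq_iff']
    intro ε hε
    have hlim : Tendsto (fun y : ℝ => 2 * √(y - x) * M) (𝓝[>] x) (𝓝 0) := by
      have : Continuous fun y : ℝ => 2 * √(y - x) * M := by fun_prop
      have h := (this.tendsto x).mono_left (nhdsWithin_le_nhds (s := Set.Ioi x))
      simpa using h
    have h3 := hlim.eventually_lt_const (u := ε / 3) (by positivity)
    obtain ⟨y, hy1, hy2⟩ := mem_nhdsGT_iff_exists_Ioo_subset.1
      (h3.and (Ioo_mem_nhdsGT (lt_add_one x)))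
    -- A rational point just to the right of `x` carries the Cauchy property over to `x`, at a cost
    -- of `ε / 3` for each of the two functions.
    obtain ⟨r, hr1, hr2⟩ := exists_rat_btwn (show x < y from hy1)
    obtain ⟨h4, h5⟩ := hy2 ⟨hr1, hr2⟩
    have h6 : ∀ n, |U n r - U n x| < ε / 3 := fun n =>
      (hU n x r hr1.le h5.2.le).trans_lt h4
    obtain ⟨N, hN⟩ := Metric.cauchySeq_iff'.1 (hv r).cauchySeq (ε / 3) (by positivity)
    refine ⟨N, fun n hn => ?_⟩
    have h7 := hN n hn
    have h8 := h6 (φ n)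
    have h9 := h6 (φ N)
    simp only [Function.comp, Real.dist_eq] at h7 ⊢
    rw [abs_lt] at *
    constructor <;> linarith
  choose u hu using fun x => cauchySeq_tendsto_of_complete (hc x)
  exact ⟨u, hu⟩

theorem eLpNorm_two_eq {μ : Measure ℝ} {f : ℝ → ℝ} (hf : MemLp f 2 μ) :
    eLpNorm f 2 μ = ENNReal.ofReal (√(∫ x, f x ^ 2 ∂μ)) := by
  rw [hf.eLpNorm_eq_integral_rpow_norm two_ne_zero ENNReal.ofNat_ne_top, Real.sqrt_eq_rpow]
  congr 2
  · simp
  · simp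

/-! ### Existence of periodic minimizers -/

section PeriodicMinimizer

variable {σ p q k : ℝ}

theorem tendsto_potential_of_pointwise {ι : Type*} {l : Filter ι} [l.IsCountablyGenerated]
    (hk : 1 ≤ k) {r : ℝ} (hr : 0 < r) {W : ι → ℝ → ℝ} (hW : ∀ i, MemLpCell k 2 (W i)) {B : ℝ}
    (hB : ∀ i, normSq k (W i) ≤ B) {u : ℝ → ℝ}
    (hu : ∀ x, Tendsto (fun i => A (W i) x) l (𝓝 (u x))) :
    Tendsto (fun i => potential r k (W i)) l (𝓝 (∫ x in cell k, |u x| ^ r)) := by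
  have hK : (1 : EReal) ≤ k := by exact_mod_cast hk
  refine tendsto_integral_filter_of_dominated_convergence (fun _ => √B ^ r)
    (Eventually.of_forall fun i => ?_) (Eventually.of_forall fun i => Eventually.of_forall
      fun x => ?_) ?_ (Eventually.of_forall fun x => ?_)
  · exact (((hW i).continuous_A hK).abs.rpow_const fun _ => Or.inr hr.le).aestronglyMeasurable
  · rw [Real.norm_of_nonneg (Real.rpow_nonneg (abs_nonneg _) _)]
    exact Real.rpow_le_rpow (abs_nonneg _)
      (((hW i).abs_A_le hK x).trans (Real.sqrt_le_sqrt (hB i))) hr.le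
  · rw [cell_coe]; exact integrable_const _
  · exact (hu x).abs.rpow_const (Or.inr hr.le)

/-- The limit data of a minimizing sequence force it to be a Cauchy sequence. -/
theorem tendsto_normSq_sub_of_minimizing (hσ : 0 < σ ^ 2) (hp : 2 < p) (hq : 1 < q)
    (hqp : q < p) (hk : 1 ≤ k) {W : ℕ → ℝ → ℝ} (hW : ∀ n, W n ∈ nehari σ p q k) {B N Q P : ℝ}
    {u : ℝ → ℝ} (hB : ∀ n, normSq k (W n) ≤ B)
    (hu : ∀ x, Tendsto (fun n => A (W n) x) atTop (𝓝 (u x)))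
    (hN : Tendsto (fun n => normSq k (W n)) atTop (𝓝 N))
    (hQ : Q = ∫ x in cell k, |u x| ^ q) (hP : P = ∫ x in cell k, |u x| ^ p)
    (hNpos : 0 < N) (hroot : σ ^ 2 * N + q * Q - p * P = 0)
    (hell : ell σ p q k = 1 / 2 * (σ ^ 2 * N) + Q - P) :
    Tendsto (fun z : ℕ × ℕ => normSq k (fun x => W z.2 x + (-1) * W z.1 x)) atTop (𝓝 0) := by
  have hK : (1 : EReal) ≤ k := by exact_mod_cast hk
  have hL : ∀ n, MemLpCell k 2 (W n) := fun n => (hW n).1.1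
  obtain ⟨δ, hδ0, hδ⟩ := exists_amplitude hσ hp
  have hB0 : 0 < B := hNpos.trans_le (le_of_tendsto' hN hB)
  have t1 : Tendsto (fun z : ℕ × ℕ => z.1) atTop atTop := by
    rw [← prod_atTop_atTop_eq]; exact tendsto_fst
  have t2 : Tendsto (fun z : ℕ × ℕ => z.2) atTop atTop := by
    rw [← prod_atTop_atTop_eq]; exact tendsto_snd
  set η : ℕ × ℕ → ℝ → ℝ := fun z x => W z.2 x + (-1) * W z.1 x with hη
  have hηL : ∀ z, MemLpCell k 2 (η z) := fun z => (hL z.2).add ((hL z.1).const_mul (-1))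
  -- `Z` is the midpoint of two members of the sequence. Its averages have the same limit `u`, while
  -- by the parallelogram law its squared norm drops by a quarter of `normSq k (η z)`.
  set Z : ℕ × ℕ → ℝ → ℝ := fun z x => W z.1 x + 1 / 2 * η z x with hZ
  have hZL : ∀ z, MemLpCell k 2 (Z z) := fun z => (hL z.1).add ((hηL z).const_mul (1 / 2))
  have hpar : ∀ z : ℕ × ℕ, normSq k (Z z)
      = (normSq k (W z.1) + normSq k (W z.2)) / 2 - normSq k (η z) / 4 := by
    intro z
    have h1 := normSq_add (hL z.1) (hηL z) (1 / 2)
    have h2 := normSq_add (hL z.1) (hηL z) 1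
    have h3 : (fun x => W z.1 x + 1 * η z x) = W z.2 := by
      ext x; simp only [hη]; ring
    rw [h3] at h2
    simp only [hZ]
    linarith
  have hZB : ∀ z, normSq k (Z z) ≤ B := fun z => by
    have := normSq_nonneg k (η z)
    linarith [hpar z, hB z.1, hB z.2]
  have hZu : ∀ x, Tendsto (fun z => A (Z z) x) atTop (𝓝 (u x)) := by
    intro x
    have e : ∀ z : ℕ × ℕ, A (Z z) x = A (W z.1) x + 1 / 2 * (A (W z.2) x + (-1) * A (W z.1) x) :=
      fun z => by
        rw [A_add_const_mul hK (hL z.1) (hηL z), A_add_const_mul hK (hL z.2) (hL z.1)]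
    have h1 := (hu x).comp t1
    have h2 := (hu x).comp t2
    have := h1.add ((h2.add (h1.const_mul (-1))).const_mul (1 / 2))
    rw [show u x + 1 / 2 * (u x + -1 * u x) = u x by ring] at this
    simp only [e]
    exact this
  have hZQ := tendsto_potential_of_pointwise (r := q) hk (by linarith) hZL hZB hZu
  have hZP := tendsto_potential_of_pointwise (r := p) hk (by linarith) hZL hZB hZu
  rw [← hQ] at hZQ
  rw [← hP] at hZP
  have hQ0 : 0 ≤ Q := hQ ▸ integral_nonneg fun _ => Real.rpow_nonneg (abs_nonneg _) _
  have hPpos : 0 < P := by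
    have h1 : 0 < σ ^ 2 * N := mul_pos hσ hNpos
    have h2 : 0 ≤ q * Q := by positivity
    exact (mul_pos_iff_of_pos_left (by linarith : 0 < p)).1 (by linarith)
  set S : ℕ × ℕ → ℝ := fun z => (normSq k (W z.1) + normSq k (W z.2)) / 2 with hS
  have hSN : Tendsto S atTop (𝓝 N) := by
    have := ((hN.comp t1).add (hN.comp t2)).div_const 2
    simpa using this
  have h2neg : ∀ᶠ z in atTop, σ ^ 2 * S z * 2 ^ 2 + q * potential q k (Z z) * 2 ^ q
      - p * potential p k (Z z) * 2 ^ p < 0 := by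
    have h1 := fibre_neg_of_one_lt hp hqp (mul_pos hσ hNpos) hQ0 hq hroot one_lt_two
    have h2 := (((hSN.const_mul (σ ^ 2)).mul_const (2 ^ 2)).add
      ((hZQ.const_mul q).mul_const (2 ^ q))).sub ((hZP.const_mul p).mul_const (2 ^ p))
    exact h2.eventually_lt_const h1
  -- The cost of replacing the data of the midpoint by their limits at scales `t < 2`; the weight `2
  -- * σ ^ 2` is `1 / 2 * σ ^ 2 * t ^ 2` at `t = 2`.
  set err : ℕ × ℕ → ℝ := fun z => 2 * σ ^ 2 * |S z - N| + 2 ^ q * |potential q k (Z z) - Q|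
    + 2 ^ p * |potential p k (Z z) - P| with herr
  have herr0 : Tendsto (fun z => 8 * B / (σ ^ 2 * δ ^ 2) * err z) atTop (𝓝 0) := by
    have a1 := ((hSN.sub_const N).abs.const_mul (2 * σ ^ 2)).add
      ((hZQ.sub_const Q).abs.const_mul (2 ^ q))
    have a2 := (a1.add ((hZP.sub_const P).abs.const_mul (2 ^ p))).const_mul
      (8 * B / (σ ^ 2 * δ ^ 2))
    simpa using a2
  refine squeeze_zero' (Eventually.of_forall fun z => normSq_nonneg _ _) ?_ herr0
  filter_upwards [h2neg, hZP.eventually_const_lt hPpos] with z hz hzP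
  obtain ⟨t, ht, htroot, htmem⟩ := exists_const_mul_mem_nehari hσ hp hq hqp hK
    (mem_X_coe hp hq hk (hZL z)) hzP
  have hD := normSq_nonneg k (η z)
  have hpz : normSq k (Z z) = S z - normSq k (η z) / 4 := hpar z
  have ht2 : t < 2 := by
    refine fibre_root_lt_of_neg hp hq hqp (mul_nonneg hσ.le (normSq_nonneg _ _))
      (potential_nonneg _ _ _) ht htroot two_pos (lt_of_le_of_lt ?_ hz)
    have : σ ^ 2 * normSq k (Z z) ≤ σ ^ 2 * S z := mul_le_mul_of_nonneg_left (by linarith) hσ.le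
    linarith
  -- The rescaled midpoint obeys the uniform norm bound on the manifold, which keeps `t` away from
  -- zero.
  have htlow : δ ^ 2 ≤ t ^ 2 * B := by
    have h1 := nehari.le_normSq hp hq hK htmem hδ0.le hδ
    rw [normSq_const_mul] at h1
    exact h1.trans (mul_le_mul_of_nonneg_left (hZB z) (sq_nonneg _))
  have hupper := ell_le hp hqp htmem
  rw [action_const_mul _ _ _ _ ht.le, hell] at hupper
  have hfib := fibre_le hp hq hqp (mul_pos hσ hNpos).le hQ0 hroot ht.le
  have b1 : 1 / 2 * σ ^ 2 * t ^ 2 * (S z - N) ≤ 2 * σ ^ 2 * |S z - N| := by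
    have h1 : t ^ 2 ≤ 4 := by nlinarith
    calc 1 / 2 * σ ^ 2 * t ^ 2 * (S z - N) ≤ 1 / 2 * σ ^ 2 * t ^ 2 * |S z - N| :=
          mul_le_mul_of_nonneg_left (le_abs_self _) (by positivity)
      _ ≤ 1 / 2 * σ ^ 2 * 4 * |S z - N| := by gcongr
      _ = _ := by ring
  have b2 : t ^ q * (potential q k (Z z) - Q) ≤ 2 ^ q * |potential q k (Z z) - Q| :=
    (mul_le_mul_of_nonneg_left (le_abs_self _) (by positivity)).trans
      (mul_le_mul_of_nonneg_right (Real.rpow_le_rpow ht.le ht2.le (by linarith)) (abs_nonneg _))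
  have b3 : t ^ p * (P - potential p k (Z z)) ≤ 2 ^ p * |potential p k (Z z) - P| := by
    rw [abs_sub_comm]
    calc t ^ p * (P - potential p k (Z z)) ≤ t ^ p * |P - potential p k (Z z)| :=
          mul_le_mul_of_nonneg_left (le_abs_self _) (by positivity)
      _ ≤ _ := mul_le_mul_of_nonneg_right
        (Real.rpow_le_rpow ht.le ht2.le (by linarith)) (abs_nonneg _)
  -- The rescaled midpoint has action at least `ℓ_K`, and `ℓ_K` is the maximum of the limit fibre.
  -- The norm deficit `1 / 8 * σ ^ 2 * t ^ 2 * normSq k (η z)` must therefore be absorbed by `err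
  -- z`.
  have hmain : σ ^ 2 * t ^ 2 * normSq k (η z) ≤ 8 * err z := by
    rw [hpz] at hupper
    simp only [herr]
    linarith
  have hfin : σ ^ 2 * δ ^ 2 * normSq k (η z) ≤ 8 * B * err z := by
    have c1 := mul_le_mul_of_nonneg_left htlow (mul_nonneg hσ.le hD)
    have c2 := mul_le_mul_of_nonneg_left hmain hB0.le
    linarith
  have hpos : 0 < σ ^ 2 * δ ^ 2 := by positivity
  rw [div_mul_eq_mul_div, le_div_iff₀ hpos]
  linarith

theorem normSq_le_of_action_le {K : EReal} {W : ℝ → ℝ} (hσ : 0 < σ ^ 2) (hp : 2 < p)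
    (hqp : q < p) (h : W ∈ nehari σ p q K) {C : ℝ} (hC : action σ p q K W ≤ C) :
    normSq K W ≤ C / ((1 / 2 - 1 / p) * σ ^ 2) := by
  have h1 : 1 / p < 1 / 2 := one_div_lt_one_div_of_lt two_pos hp
  have h2 : q / p < 1 := (div_lt_one (by linarith)).2 hqp
  have h3 := potential_nonneg q K W
  rw [action_eq_of_nehari hp h] at hC
  rw [le_div_iff₀ (mul_pos (by linarith) hσ)]
  have h4 : 0 ≤ (1 - q / p) * potential q K W := mul_nonneg (by linarith) h3
  linarith

theorem exists_limit_of_cauchy (hk : 1 ≤ k) {W : ℕ → ℝ → ℝ} (hW : ∀ n, MemLpCell k 2 (W n))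
    (hc : Tendsto (fun z : ℕ × ℕ => normSq k (fun x => W z.2 x + (-1) * W z.1 x)) atTop (𝓝 0)) :
    ∃ V : ℝ → ℝ, MemLpCell k 2 V ∧
      Tendsto (fun n => normSq k (fun x => W n x + (-1) * V x)) atTop (𝓝 0) ∧
      Tendsto (fun n => normSq k (W n)) atTop (𝓝 (normSq k V)) := by
  have hk2 : 0 < 2 * k := by linarith
  set μ := volume.restrict (cell (k : EReal)) with hμ
  set w : ℕ → Lp ℝ 2 μ := fun n => (hW n).memLp_two.toLp (W n) with hw
  have hdist : ∀ m n, dist (w m) (w n) = √(normSq k (fun x => W m x + (-1) * W n x)) := by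
    intro m n
    have hd : MemLp (W m - W n) 2 μ := (hW m).memLp_two.sub (hW n).memLp_two
    rw [dist_eq_norm, hw, ← MemLp.toLp_sub, Lp.norm_toLp, eLpNorm_two_eq hd,
      ENNReal.toReal_ofReal (Real.sqrt_nonneg _)]
    simp [normSq, sub_eq_add_neg, hμ]
  have hcau : CauchySeq w := by
    rw [cauchySeq_iff_tendsto_dist_atTop_0]
    have := hc.sqrt
    rw [Real.sqrt_zero] at this
    exact this.congr fun z => by rw [dist_comm, hdist]
  obtain ⟨g, hg⟩ := cauchySeq_tendsto_of_complete hcau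
  have hgL : MemLp g 2 (volume.restrict (Set.Ioc (-k) k)) := by
    rw [← cell_coe]; exact Lp.memLp g
  -- The `L²` limit is determined only on the cell; periodizing it supplies a representative on the
  -- line.
  refine ⟨periodize k hk2 g, memLpCell_periodize hk2 hgL, ?_, ?_⟩
  swap
  · have h1 := hg.norm.pow 2
    have e1 : ∀ f : ℝ → ℝ, ∀ hf : MemLp f 2 μ, ‖hf.toLp f‖ ^ 2 = normSq k f := fun f hf => by
      rw [Lp.norm_toLp, eLpNorm_two_eq hf, ENNReal.toReal_ofReal (Real.sqrt_nonneg _),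
        Real.sq_sqrt (integral_nonneg fun _ => sq_nonneg _), normSq]
    have e2 : ‖g‖ ^ 2 = normSq k (periodize k hk2 g) := by
      conv_lhs => rw [← Lp.toLp_coeFn g (Lp.memLp g)]
      rw [e1, normSq, normSq, cell_coe]
      exact setIntegral_congr_fun measurableSet_Ioc fun x hx => by
        simp only [periodize_of_mem hk2 _ hx]
    rw [e2] at h1
    exact h1.congr fun n => e1 _ _
  have h1 := (tendsto_iff_dist_tendsto_zero.1 hg).pow 2
  rw [zero_pow two_ne_zero] at h1
  refine h1.congr fun n => ?_
  have hd : MemLp (W n - ⇑g) 2 μ := (hW n).memLp_two.sub (Lp.memLp g)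
  have e : w n - g = hd.toLp (W n - ⇑g) := by
    conv_lhs => rw [← Lp.toLp_coeFn g (Lp.memLp g), hw, ← MemLp.toLp_sub]
  rw [dist_eq_norm, e, Lp.norm_toLp, eLpNorm_two_eq hd, ENNReal.toReal_ofReal (Real.sqrt_nonneg _),
    Real.sq_sqrt (integral_nonneg fun _ => sq_nonneg _), normSq]
  refine setIntegral_congr_fun (measurableSet_cell (by exact_mod_cast hk)) fun x hx => ?_
  rw [cell_coe] at hx
  simp [periodize_of_mem hk2 _ hx, sub_eq_add_neg]

/-- On a bounded cell the action attains its minimum on the Nehari manifold. -/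
theorem exists_periodic_minimizer (hσ : 0 < σ ^ 2) (hp : 2 < p) (hq : 1 < q) (hqp : q < p)
    (hk : 1 ≤ k) : ∃ W ∈ nehari σ p q k, action σ p q k W = ell σ p q k := by
  have hK : (1 : EReal) ≤ k := by exact_mod_cast hk
  obtain ⟨δ, hδ0, hδ⟩ := exists_amplitude hσ hp
  obtain ⟨a, -, ha, hmem⟩ := exists_seq_tendsto_sInf
    ((nehari_coe_nonempty hσ hp hq hqp hk).image (action σ p q k))
    ⟨0, by rintro _ ⟨V, hV, rfl⟩; exact action_nonneg_of_nehari hp hqp hV⟩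
  choose W hW hWa using hmem
  obtain ⟨C, hC⟩ := ha.bddAbove_range
  set B := C / ((1 / 2 - 1 / p) * σ ^ 2) with hBdef
  have hB : ∀ n, normSq k (W n) ≤ B := fun n =>
    normSq_le_of_action_le hσ hp hqp (hW n) ((hWa n).trans_le (hC ⟨n, rfl⟩))
  have hL : ∀ n, MemLpCell k 2 (W n) := fun n => (hW n).1.1
  obtain ⟨φ, hφ, u, hu⟩ := exists_subseq_tendsto_pointwise (U := fun n => A (W n)) (M := √B)
    (fun n x => ((hL n).abs_A_le hK x).trans (Real.sqrt_le_sqrt (hB n)))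
    (fun n x y hxy hy => ((hL n).abs_A_sub_le hK hxy hy).trans
      (mul_le_mul_of_nonneg_left (Real.sqrt_le_sqrt (hB n)) (by positivity)))
  obtain ⟨N, -, ψ, hψ, hN⟩ := (isCompact_Icc (a := (0 : ℝ)) (b := B)).tendsto_subseq
    (x := fun n => normSq k (W (φ n))) fun n => ⟨normSq_nonneg _ _, hB _⟩
  set V : ℕ → ℝ → ℝ := fun n => W (φ (ψ n)) with hV
  have hVu : ∀ x, Tendsto (fun n => A (V n) x) atTop (𝓝 (u x)) := fun x =>
    (hu x).comp hψ.tendsto_atTop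
  have hVB : ∀ n, normSq k (V n) ≤ B := fun n => hB _
  have hVL : ∀ n, MemLpCell k 2 (V n) := fun n => hL _
  have hVN : Tendsto (fun n => normSq k (V n)) atTop (𝓝 N) := hN
  have hVQ := tendsto_potential_of_pointwise (r := q) hk (by linarith) hVL hVB hVu
  have hVP := tendsto_potential_of_pointwise (r := p) hk (by linarith) hVL hVB hVu
  have hNpos : 0 < N := lt_of_lt_of_le (by positivity : 0 < δ ^ 2)
    (ge_of_tendsto' hVN fun n => nehari.le_normSq hp hq hK (hW _) hδ0.le hδ)
  have hroot : σ ^ 2 * N + q * (∫ x in cell k, |u x| ^ q) - p * (∫ x in cell k, |u x| ^ p) = 0 := by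
    have := ((hVN.const_mul (σ ^ 2)).add (hVQ.const_mul q)).sub (hVP.const_mul p)
    exact tendsto_nhds_unique this (tendsto_const_nhds.congr fun n => ((hW _).2.2).symm)
  have hell : ell σ p q k = 1 / 2 * (σ ^ 2 * N) + (∫ x in cell k, |u x| ^ q)
      - ∫ x in cell k, |u x| ^ p := by
    have h1 := (((hVN.const_mul (1 / 2 * σ ^ 2)).add hVQ).sub hVP)
    rw [mul_assoc] at h1
    refine tendsto_nhds_unique (ha.comp (hφ.comp hψ).tendsto_atTop) (h1.congr fun n => ?_)
    exact hWa _
  have hc := tendsto_normSq_sub_of_minimizing hσ hp hq hqp hk (fun n => hW (φ (ψ n))) hVB hVu hVN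
    rfl rfl hNpos hroot hell
  obtain ⟨Z, hZ, hlim, hlimN⟩ := exists_limit_of_cauchy hk hVL hc
  -- `L²` convergence forces uniform convergence of the averages, so the potentials of `Z` are the
  -- limits found above.
  have hAZ : A Z = u := by
    ext x
    refine tendsto_nhds_unique ?_ (hVu x)
    rw [tendsto_iff_dist_tendsto_zero]
    have h0 := hlim.sqrt
    rw [Real.sqrt_zero] at h0
    refine squeeze_zero (fun _ => dist_nonneg) (fun n => ?_) h0
    have := ((hVL n).add (hZ.const_mul (-1))).abs_A_le hK x
    rw [A_add_const_mul hK (hVL n) hZ] at this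
    rw [Real.dist_eq]
    convert this using 2
    ring
  have hNZ : normSq k Z = N := tendsto_nhds_unique hlimN hVN
  refine ⟨Z, ⟨mem_X_coe hp hq hk hZ, not_ae_eq_zero_of_normSq_pos (K := k) (hNZ ▸ hNpos), ?_⟩, ?_⟩
  · simp only [nehariFunctional, potential, hNZ, hAZ]
    exact hroot
  · simp only [action, potential, hNZ, hAZ]
    rw [hell]; ring

end PeriodicMinimizer

/-! ### Fatou's lemma and strong convergence -/

/-- Fatou's lemma bounds by the lower limit, so it suffices that the integrals are small infinitely
often. This allows proofs by contradiction without extracting a subsequence. -/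
theorem integral_le_of_frequently_le {f : ℕ → ℝ → ℝ} {g : ℝ → ℝ} {C : ℝ}
    (hi : ∀ n, Integrable (f n)) (h0 : ∀ n x, 0 ≤ f n x)
    (hlim : ∀ᵐ x, Tendsto (fun n => f n x) atTop (𝓝 (g x)))
    (hC : ∃ᶠ n in atTop, ∫ x, f n x ≤ C) : Integrable g ∧ ∫ x, g x ≤ C := by
  have hg0 : 0 ≤ᵐ[volume] g := hlim.mono fun x hx => ge_of_tendsto' hx fun n => h0 n x
  have hgm : AEStronglyMeasurable g volume :=
    aestronglyMeasurable_of_tendsto_ae atTop (fun n => (hi n).aestronglyMeasurable) hlim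
  have key : ∫⁻ x, ENNReal.ofReal (g x) ≤ ENNReal.ofReal C := by
    calc ∫⁻ x, ENNReal.ofReal (g x)
        = ∫⁻ x, liminf (fun n => ENNReal.ofReal (f n x)) atTop := by
          refine lintegral_congr_ae (hlim.mono fun x hx => ?_)
          exact ((ENNReal.continuous_ofReal.tendsto _).comp hx).liminf_eq.symm
      _ ≤ liminf (fun n => ∫⁻ x, ENNReal.ofReal (f n x)) atTop :=
          lintegral_liminf_le' fun n => (hi n).aestronglyMeasurable.aemeasurable.ennreal_ofReal
      _ ≤ ENNReal.ofReal C := by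
          refine liminf_le_of_frequently_le' (hC.mono fun n hn => ?_)
          rw [← ofReal_integral_eq_lintegral_ofReal (hi n) (Eventually.of_forall (h0 n))]
          exact ENNReal.ofReal_le_ofReal hn
  have hgi : Integrable g := by
    refine ⟨hgm, ?_⟩
    rw [hasFiniteIntegral_iff_ofReal hg0]
    exact key.trans_lt ENNReal.ofReal_lt_top
  refine ⟨hgi, ?_⟩
  have hC0 : 0 ≤ C := by
    obtain ⟨n, hn⟩ := hC.exists
    exact (integral_nonneg (h0 n)).trans hn
  rw [← ofReal_integral_eq_lintegral_ofReal hgi hg0] at key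
  exact (ENNReal.ofReal_le_ofReal_iff hC0).1 key

/-- Fatou's lemma for convergent integrals. -/
theorem integral_le_of_tendsto {f : ℕ → ℝ → ℝ} {g : ℝ → ℝ} {c : ℝ}
    (hi : ∀ n, Integrable (f n)) (h0 : ∀ n x, 0 ≤ f n x)
    (hlim : ∀ᵐ x, Tendsto (fun n => f n x) atTop (𝓝 (g x)))
    (hc : Tendsto (fun n => ∫ x, f n x) atTop (𝓝 c)) : Integrable g ∧ ∫ x, g x ≤ c := by
  have key : ∀ C, c < C → Integrable g ∧ ∫ x, g x ≤ C := fun C hC =>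
    integral_le_of_frequently_le hi h0 hlim
      ((hc.eventually_lt_const hC).mono fun n hn => hn.le).frequently
  exact ⟨(key (c + 1) (by linarith)).1, le_of_forall_gt_imp_ge_of_dense fun C hC => (key C hC).2⟩

/-- Pointwise convergence and convergence of the norms imply strong convergence in `L²`. -/
theorem tendsto_integral_sq_sub {f : ℕ → ℝ → ℝ} {g : ℝ → ℝ} (hf : ∀ n, MemLp (f n) 2 volume)
    (hg : MemLp g 2 volume) (hlim : ∀ᵐ x, Tendsto (fun n => f n x) atTop (𝓝 (g x)))
    (hc : Tendsto (fun n => ∫ x, f n x ^ 2) atTop (𝓝 (∫ x, g x ^ 2))) :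
    Tendsto (fun n => ∫ x, (g x - f n x) ^ 2) atTop (𝓝 0) := by
  set N := ∫ x, g x ^ 2 with hN
  have ig := hg.integrable_sq
  have iF : ∀ n, Integrable (fun x => f n x ^ 2) := fun n => (hf n).integrable_sq
  have id : ∀ n, Integrable (fun x => (g x - f n x) ^ 2) := fun n => (hg.sub (hf n)).integrable_sq
  have i1 : ∀ n, Integrable (fun x => 2 * f n x ^ 2 + 2 * g x ^ 2) := fun n =>
    ((iF n).const_mul 2).add (ig.const_mul 2)
  have i2 : ∀ n, Integrable (fun x => 2 * f n x ^ 2 + 2 * g x ^ 2 - (g x - f n x) ^ 2) :=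
    fun n => (i1 n).sub (id n)
  have e : ∀ n, ∫ x, (2 * f n x ^ 2 + 2 * g x ^ 2 - (g x - f n x) ^ 2)
      = 2 * (∫ x, f n x ^ 2) + 2 * N - ∫ x, (g x - f n x) ^ 2 := fun n => by
    rw [integral_sub (i1 n) (id n), integral_add ((iF n).const_mul 2) (ig.const_mul 2),
      integral_const_mul, integral_const_mul]
  rw [tendsto_order]
  refine ⟨fun a ha => Eventually.of_forall fun n =>
    ha.trans_le (integral_nonneg fun _ => sq_nonneg _), fun ε hε => ?_⟩
  by_contra hcon
  rw [not_eventually] at hcon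
  have hsmall : ∀ᶠ n in atTop, ∫ x, f n x ^ 2 < N + ε / 4 :=
    hc.eventually_lt_const (by linarith)
  -- The integrand is nonnegative and tends to `4 * g x ^ 2`. An error of at least `ε` infinitely
  -- often would give `2 * (N + ε / 4) + 2 * N - ε = 4 * N - ε / 2`, contradicting Fatou.
  have hfreq : ∃ᶠ n in atTop, ∫ x, (2 * f n x ^ 2 + 2 * g x ^ 2 - (g x - f n x) ^ 2)
      ≤ 4 * N - ε / 2 := by
    refine (hcon.and_eventually hsmall).mono fun n hn => ?_
    rw [e]
    have := not_lt.1 hn.1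
    linarith [hn.2]
  have := (integral_le_of_frequently_le (g := fun x => 4 * g x ^ 2) i2
    (fun n x => by nlinarith [sq_nonneg (g x + f n x)]) (hlim.mono fun x hx => ?_) hfreq).2
  · rw [integral_const_mul] at this
    linarith
  · have h1 := (((hx.pow 2).const_mul 2).add_const (2 * g x ^ 2)).sub
      ((tendsto_const_nhds.sub hx).pow 2) (a := 2 * g x ^ 2 + 2 * g x ^ 2) (b := (g x - g x) ^ 2)
    convert h1 using 2
    ring

theorem tendsto_A_of_dominated {f : ℕ → ℝ → ℝ} {g : ℝ → ℝ} {M : ℝ}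
    (hm : ∀ n, AEStronglyMeasurable (f n) volume) (hM : ∀ n, ∀ᵐ x, |f n x| ≤ M)
    (hlim : ∀ᵐ x, Tendsto (fun n => f n x) atTop (𝓝 (g x))) (x : ℝ) :
    Tendsto (fun n => A (f n) x) atTop (𝓝 (A g x)) := by
  refine intervalIntegral.tendsto_integral_filter_of_dominated_convergence (fun _ => M)
    (Eventually.of_forall fun n => (hm n).restrict)
    (Eventually.of_forall fun n => (hM n).mono fun y hy _ => hy) intervalIntegrable_const
    (hlim.mono fun y hy _ => hy)

/-! ### Translation invariance -/

section Translation

variable {σ p q : ℝ} {K : EReal} {W : ℝ → ℝ}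

theorem MemLpCell.comp_add_right {r : ℝ} (hr : 0 < r) (hK : 1 ≤ K) (h : MemLpCell K r W)
    (hm : AEStronglyMeasurable W volume) (s : ℝ) : MemLpCell K r (fun x => W (x + s)) := by
  refine ⟨h.perOn.add_right s, ?_⟩
  have hm' : AEStronglyMeasurable (fun x => W (x + s)) volume :=
    hm.comp_measurePreserving (measurePreserving_add_right volume s)
  rw [memLp_iff_integrable_abs_rpow hr hm'.restrict]
  exact (h.perOn.comp (fun y => |y| ^ r)).integrableOn_cell_add hK
    ((memLp_iff_integrable_abs_rpow hr hm.restrict).1 h.2) s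

theorem MemLpCell.normSq_comp_add_right (hK : 1 ≤ K) (h : MemLpCell K 2 W) (s : ℝ) :
    normSq K (fun x => W (x + s)) = normSq K W :=
  (h.perOn.comp (fun y => y ^ 2)).integral_cell_add hK s

theorem MemLpCell.potential_comp_add_right (r : ℝ) (hK : 1 ≤ K) (h : MemLpCell K 2 W) (s : ℝ) :
    potential r K (fun x => W (x + s)) = potential r K W := by
  simp only [potential, A_comp_add_right]
  exact (h.perOn.A.comp (fun y => |y| ^ r)).integral_cell_add hK s

theorem comp_add_right_mem_nehari (hp : 2 < p) (hq : 1 < q) (hK : 1 ≤ K)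
    (h : W ∈ nehari σ p q K) (s : ℝ) : (fun x => W (x + s)) ∈ nehari σ p q K := by
  have hL := h.1.1
  have hN := hL.normSq_comp_add_right hK s
  refine ⟨(mem_X_iff hp hq hK).2 ⟨hL.comp_add_right two_pos hK
    (hL.locallyIntegrable hK).aestronglyMeasurable s, ?_⟩,
    not_ae_eq_zero_of_normSq_pos (K := K) ?_, ?_⟩
  · simp only [A_comp_add_right]
    exact (hL.perOn.A.comp (fun y => |y| ^ q)).integrableOn_cell_add hK
      ((mem_X_iff hp hq hK).1 h.1).2 s
  · rw [hN]; exact hL.normSq_pos hK h.2.1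
  · simp only [nehariFunctional, hN, hL.potential_comp_add_right _ hK]
    exact h.2.2

theorem action_comp_add_right (hK : 1 ≤ K) (h : MemLpCell K 2 W) (s : ℝ) :
    action σ p q K (fun x => W (x + s)) = action σ p q K W := by
  simp only [action, h.normSq_comp_add_right hK, h.potential_comp_add_right _ hK]

end Translation

/-! ### The limit of infinite period -/

section SolitaryLimit

variable {σ p q : ℝ}

theorem integral_indicator_cell_sq {k : ℝ} (W : ℝ → ℝ) :
    ∫ x, (cell (k : EReal)).indicator W x ^ 2 = normSq k W := by
  rw [indicator_sq, cell_coe, integral_indicator measurableSet_Ioc, normSq, cell_coe]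

theorem tendsto_indicator_cell {k : ℕ → ℝ} (hk : Tendsto k atTop atTop) {f : ℕ → ℝ → ℝ}
    {g : ℝ → ℝ} {x : ℝ} (h : Tendsto (fun n => f n x) atTop (𝓝 (g x))) :
    Tendsto (fun n => (cell (k n : EReal)).indicator (f n) x) atTop (𝓝 (g x)) := by
  refine h.congr' ?_
  filter_upwards [hk.eventually_gt_atTop |x|] with n hn
  rw [abs_lt] at hn
  rw [cell_coe]
  have : x ∈ Set.Ioc (-k n) (k n) := ⟨hn.1, hn.2.le⟩
  exact (Set.indicator_of_mem this _).symm

theorem MemLpCell.indicator_cell {k : ℝ} {W : ℝ → ℝ} (h : MemLpCell k 2 W) :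
    MemLpCell ⊤ 2 ((cell (k : EReal)).indicator W) := by
  refine memLpCell_top.2 ?_
  rw [memLp_indicator_iff_restrict (by rw [cell_coe]; exact measurableSet_Ioc)]
  exact h.2

theorem indicator_cell_mem_X {k : ℝ} (hp : 2 < p) (hq : 1 < q) {W : ℝ → ℝ}
    (h : MemLpCell k 2 W) : (cell (k : EReal)).indicator W ∈ X p q ⊤ := by
  refine mem_X_top_of_integrable hp hq h.indicator_cell ?_
  have := h.memLp_two
  rw [cell_coe] at *
  exact (integrable_indicator_iff measurableSet_Ioc).2 (this.integrable (by norm_num))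

/-- Translating a point of large amplitude to the origin prevents the limit `K → ∞` from vanishing.
-/
theorem exists_centred_periodic_minimizer (hσ : 0 < σ ^ 2) (hp : 2 < p) (hq : 1 < q)
    (hqp : q < p) {δ : ℝ} (hδ0 : 0 < δ) (hδ : p * δ ^ (p - 2) < σ ^ 2) {k : ℝ} (hk : 1 ≤ k) :
    ∃ W ∈ nehari σ p q k, action σ p q k W = ell σ p q k ∧ δ ≤ |A W 0| := by
  have hK : (1 : EReal) ≤ k := by exact_mod_cast hk
  obtain ⟨Z, hZ, hZa⟩ := exists_periodic_minimizer hσ hp hq hqp hk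
  obtain ⟨s, hs⟩ := nehari.exists_le_abs_A hp hq hK hZ hδ0.le hδ
  refine ⟨fun x => Z (x + s), comp_add_right_mem_nehari hp hq hK hZ s, ?_, ?_⟩
  · rw [action_comp_add_right hK hZ.1.1, hZa]
  · rwa [A_comp_add_right, zero_add]

/-- The pointwise limit of periodic travelling waves with uniformly bounded norms solves the
travelling wave equation on the line. -/
theorem exists_pointwise_limit (hσ : 0 < σ ^ 2) (hp : 2 < p) (hq : 1 < q) {k : ℕ → ℝ}
    (hk : ∀ n, 1 ≤ k n) {W : ℕ → ℝ → ℝ} {B : ℝ} (hL : ∀ n, MemLpCell (k n) 2 (W n))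
    (hB : ∀ n, normSq (k n) (W n) ≤ B) (hG : ∀ n, gradAction σ p q (W n) =ᵐ[volume] 0)
    {u : ℝ → ℝ} (hu : ∀ x, Tendsto (fun n => A (W n) x) atTop (𝓝 (u x))) :
    ∃ V : ℝ → ℝ, (∀ᵐ x, Tendsto (fun n => W n x) atTop (𝓝 (V x))) ∧ A V = u ∧
      gradAction σ p q V = 0 := by
  have hK : ∀ n, (1 : EReal) ≤ k n := fun n => by exact_mod_cast hk n
  have hp1 : 1 < p := by linarith
  have hAB : ∀ n x, |A (W n) x| ≤ √B := fun n x =>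
    ((hL n).abs_A_le (hK n) x).trans (Real.sqrt_le_sqrt (hB n))
  have hlim : ∀ {r : ℝ}, 1 < r → ∀ x, Tendsto (fun n => A (fun s => Psi r (A (W n) s)) x) atTop
      (𝓝 (A (fun s => Psi r (u s)) x)) := fun {r} hr x =>
    tendsto_A_of_dominated (M := r * √B ^ (r - 1))
      (fun n => ((hL n).continuous_Psi_A hr (hK n)).aestronglyMeasurable)
      (fun n => Eventually.of_forall fun s => abs_Psi_le hr (hAB n s))
      (Eventually.of_forall fun s => ((continuous_Psi hr).tendsto _).comp (hu s)) x
  have hAPsi : ∀ {r : ℝ}, 1 < r → ∀ n x, |A (fun s => Psi r (A (W n) s)) x| ≤ r * √B ^ (r - 1) :=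
    fun hr n x => abs_A_le_of_bound (fun s => abs_Psi_le hr (hAB n s)) x
  -- The equation is solved for `W`. The right-hand side depends on `A W` alone, which upgrades
  -- pointwise convergence of `A (W n)` to almost everywhere convergence of `W n`.
  set V : ℝ → ℝ := fun x => (σ ^ 2)⁻¹ *
    (A (fun s => Psi p (u s)) x - A (fun s => Psi q (u s)) x) with hV
  have heq : ∀ n, ∀ᵐ x, W n x = (σ ^ 2)⁻¹ *
      (A (fun s => Psi p (A (W n) s)) x - A (fun s => Psi q (A (W n) s)) x) := fun n =>
    (hG n).mono fun x hx => by
      simp only [gradAction, Pi.zero_apply] at hx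
      rw [eq_inv_mul_iff_mul_eq₀ hσ.ne']
      linarith
  have hWV : ∀ᵐ x, Tendsto (fun n => W n x) atTop (𝓝 (V x)) := by
    filter_upwards [ae_all_iff.2 heq] with x hx
    simp only [hx]
    exact ((hlim hp1 x).sub (hlim hq x)).const_mul _
  have hAV : A V = u := by
    ext x
    refine tendsto_nhds_unique (tendsto_A_of_dominated
      (M := (σ ^ 2)⁻¹ * (p * √B ^ (p - 1) + q * √B ^ (q - 1)))
      (fun n => ((hL n).locallyIntegrable (hK n)).aestronglyMeasurable) (fun n => ?_) hWV x) (hu x)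
    filter_upwards [heq n] with y hy
    rw [hy, abs_mul, abs_of_pos (inv_pos.2 hσ)]
    refine mul_le_mul_of_nonneg_left ?_ (inv_nonneg.2 hσ.le)
    have h1 := abs_le.1 (hAPsi hp1 n y)
    have h2 := abs_le.1 (hAPsi hq n y)
    rw [abs_le]
    constructor <;> linarith [h1.1, h1.2, h2.1, h2.2]
  refine ⟨V, hWV, hAV, ?_⟩
  ext x
  rw [gradAction, hAV]
  simp only [hV, Pi.zero_apply, mul_inv_cancel_left₀ hσ.ne']
  ring

/-- Convergence of periodic ground waves to a solitary ground wave along a subsequence. -/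
theorem exists_subseq_tendsto_groundWave (hσ : 0 < σ ^ 2) (hp : 2 < p) (hq : 1 < q)
    (hqp : q < p) {K : ℕ → ℝ} (hK1 : ∀ n, 1 ≤ K n) (hKt : Tendsto K atTop atTop) :
    ∃ φ : ℕ → ℕ, StrictMono φ ∧ ∃ (W : ℕ → ℝ → ℝ) (V : ℝ → ℝ),
      (∀ n, W n ∈ nehari σ p q (K (φ n)) ∧
        IsMinOn (action σ p q (K (φ n))) (nehari σ p q (K (φ n))) (W n)) ∧
      V ∈ nehari σ p q ⊤ ∧ IsMinOn (action σ p q ⊤) (nehari σ p q ⊤) V ∧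
      Tendsto (fun n => ell σ p q (K (φ n))) atTop (𝓝 (ell σ p q ⊤)) ∧
      Tendsto (fun n => eLpNorm (V - (cell (K (φ n) : EReal)).indicator (W n)) 2 volume) atTop
        (𝓝 0) := by
  have htop : (1 : EReal) ≤ ⊤ := le_top
  have hK : ∀ n, (1 : EReal) ≤ K n := fun n => by exact_mod_cast hK1 n
  obtain ⟨δ, hδ0, hδ⟩ := exists_amplitude hσ hp
  choose Z hZ hZa hZδ using fun n =>
    exists_centred_periodic_minimizer hσ hp hq hqp hδ0 hδ (hK1 n)
  have hZL : ∀ n, MemLpCell (K n) 2 (Z n) := fun n => (hZ n).1.1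
  have hZmin : ∀ n, IsMinOn (action σ p q (K n)) (nehari σ p q (K n)) (Z n) := fun n =>
    (isMinOn_iff_action_le_ell hp hqp (hZ n)).2 (hZa n).le
  obtain ⟨W₀, hW₀⟩ := nehari_top_nonempty hσ hp hq hqp
  have hbdd : BddAbove (Set.range fun n => ell σ p q (K n)) := by
    refine IsBoundedUnder.bddAbove_range ⟨action σ p q ⊤ W₀ + 1, ?_⟩
    exact (hKt.eventually (eventually_ell_lt hσ hp hq hqp hW₀ (lt_add_one _))).mono
      fun n hn => hn.le
  obtain ⟨C, hC⟩ := hbdd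
  set c₁ : ℝ := (1 / 2 - 1 / p) * σ ^ 2 with hc₁
  set c₂ : ℝ := 1 - q / p with hc₂
  have hc₁pos : 0 < c₁ :=
    mul_pos (sub_pos.2 (one_div_lt_one_div_of_lt two_pos hp)) hσ
  have hc₂pos : 0 < c₂ := sub_pos.2 ((div_lt_one (by linarith)).2 hqp)
  have hact : ∀ n, c₁ * normSq (K n) (Z n) + c₂ * potential q (K n) (Z n) = ell σ p q (K n) :=
    fun n => by rw [← hZa n, action_eq_of_nehari hp (hZ n)]
  have hCn : ∀ n, ell σ p q (K n) ≤ C := fun n => hC ⟨n, rfl⟩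
  have hNB : ∀ n, normSq (K n) (Z n) ≤ C / c₁ := fun n => by
    rw [le_div_iff₀ hc₁pos]
    have := mul_nonneg hc₂pos.le (potential_nonneg q (K n) (Z n))
    linarith [hact n, hCn n]
  have hQB : ∀ n, potential q (K n) (Z n) ≤ C / c₂ := fun n => by
    rw [le_div_iff₀ hc₂pos]
    have := mul_nonneg hc₁pos.le (normSq_nonneg (K n) (Z n))
    linarith [hact n, hCn n]
  obtain ⟨φ₁, hφ₁, u, hu⟩ := exists_subseq_tendsto_pointwise (U := fun n => A (Z n))
    (M := √(C / c₁))
    (fun n x => ((hZL n).abs_A_le (hK n) x).trans (Real.sqrt_le_sqrt (hNB n)))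
    (fun n x y hxy hy => ((hZL n).abs_A_sub_le (hK n) hxy hy).trans
      (mul_le_mul_of_nonneg_left (Real.sqrt_le_sqrt (hNB n)) (by positivity)))
  obtain ⟨⟨N, Q⟩, -, φ₂, hφ₂, hNQ⟩ := ((isCompact_Icc (a := (0 : ℝ)) (b := C / c₁)).prod
    (isCompact_Icc (a := (0 : ℝ)) (b := C / c₂))).tendsto_subseq
    (x := fun n => (normSq (K (φ₁ n)) (Z (φ₁ n)), potential q (K (φ₁ n)) (Z (φ₁ n))))
    fun n => ⟨⟨normSq_nonneg _ _, hNB _⟩, ⟨potential_nonneg _ _ _, hQB _⟩⟩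
  set φ : ℕ → ℕ := φ₁ ∘ φ₂ with hφdef
  have hφ : StrictMono φ := hφ₁.comp hφ₂
  have hN : Tendsto (fun n => normSq (K (φ n)) (Z (φ n))) atTop (𝓝 N) :=
    (continuous_fst.tendsto _).comp hNQ
  have hQ : Tendsto (fun n => potential q (K (φ n)) (Z (φ n))) atTop (𝓝 Q) :=
    (continuous_snd.tendsto _).comp hNQ
  have hu' : ∀ x, Tendsto (fun n => A (Z (φ n)) x) atTop (𝓝 (u x)) := fun x =>
    (hu x).comp hφ₂.tendsto_atTop
  have hKφ : Tendsto (fun n => K (φ n)) atTop atTop := hKt.comp hφ.tendsto_atTop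
  obtain ⟨V, hWV, hAV, hGV⟩ := exists_pointwise_limit hσ hp hq (fun n => hK1 (φ n))
    (fun n => hZL (φ n)) (fun n => hNB (φ n))
    (fun n => gradAction_ae_eq_zero_of_isMinOn hσ hp hq hqp (hK _) (hZ _) (hZmin _)) hu'
  set f : ℕ → ℝ → ℝ := fun n => (cell (K (φ n) : EReal)).indicator (Z (φ n)) with hf
  have hfL : ∀ n, MemLp (f n) 2 volume := fun n => by
    simpa using memLpCell_top.1 (hZL (φ n)).indicator_cell
  have hfV : ∀ᵐ x, Tendsto (fun n => f n x) atTop (𝓝 (V x)) :=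
    hWV.mono fun x hx => tendsto_indicator_cell hKφ hx
  have hfN : Tendsto (fun n => ∫ x, f n x ^ 2) atTop (𝓝 N) := by
    simpa only [hf, integral_indicator_cell_sq] using hN
  have hVm : AEStronglyMeasurable V volume :=
    aestronglyMeasurable_of_tendsto_ae atTop (fun n => (hfL n).aestronglyMeasurable) hfV
  -- Mass may escape to infinity, so at this stage Fatou yields only inequalities for the norm and
  -- the `q`-potential.
  obtain ⟨hVi, hVN⟩ := integral_le_of_tendsto (fun n => (hfL n).integrable_sq)
    (fun n x => sq_nonneg _) (hfV.mono fun x hx => hx.pow 2) hfN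
  have hVL2 : MemLp V 2 volume := (memLp_two_iff_integrable_sq hVm).2 hVi
  have hVL : MemLpCell ⊤ 2 V := memLpCell_top.2 (by simpa using hVL2)
  obtain ⟨hVqi, hVQ⟩ := integral_le_of_tendsto
    (f := fun n => (cell (K (φ n) : EReal)).indicator fun x => |A (Z (φ n)) x| ^ q)
    (g := fun x => |A V x| ^ q) (c := Q)
    (fun n => (integrable_indicator_iff (measurableSet_cell (hK _))).2
      ((mem_X_iff hp hq (hK _)).1 (hZ (φ n)).1).2)
    (fun n x => Set.indicator_nonneg (fun _ _ => Real.rpow_nonneg (abs_nonneg _) _) x)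
    (Eventually.of_forall fun x => tendsto_indicator_cell hKφ
      (f := fun n x => |A (Z (φ n)) x| ^ q) (g := fun x => |A V x| ^ q) (by
        rw [hAV]; exact (hu' x).abs.rpow_const (Or.inr (by linarith))))
    (by
      simp only [integral_indicator (measurableSet_cell (hK _))]
      exact hQ)
  have hVX : V ∈ X p q ⊤ := (mem_X_iff hp hq htop).2
    ⟨hVL, by rwa [cell_top, integrableOn_univ]⟩
  have hV0 : ¬ V =ᵐ[volume] 0 := fun h0 => by
    have h1 : δ ≤ |A V 0| := by
      rw [hAV]; exact ge_of_tendsto' (hu' 0).abs fun n => hZδ _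
    rw [A_congr_ae h0, show A 0 0 = 0 from A_const 0 0, abs_zero] at h1
    linarith
  -- The constraint is not passed to the limit, since the `p`-potential might lose mass; it follows
  -- from the equation for `V`.
  have hVneh : V ∈ nehari σ p q ⊤ := travellingWaves_subset_nehari hp hq htop
    ⟨hVX, hV0, by rw [hGV]⟩
  rw [← normSq_top] at hVN
  rw [← potential_top] at hVQ
  have hlimell : Tendsto (fun n => ell σ p q (K (φ n))) atTop (𝓝 (c₁ * N + c₂ * Q)) :=
    ((hN.const_mul c₁).add (hQ.const_mul c₂)).congr fun n => hact _
  have hle : ∀ V' ∈ nehari σ p q ⊤, c₁ * N + c₂ * Q ≤ action σ p q ⊤ V' := fun V' hV' =>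
    le_of_forall_gt_imp_ge_of_dense fun b hb => le_of_tendsto hlimell
      ((hKφ.eventually (eventually_ell_lt hσ hp hq hqp hV' hb)).mono fun n hn => hn.le)
  have hVact : action σ p q ⊤ V = c₁ * normSq ⊤ V + c₂ * potential q ⊤ V :=
    action_eq_of_nehari hp hVneh
  have m1 := mul_le_mul_of_nonneg_left hVN hc₁pos.le
  have m2 := mul_le_mul_of_nonneg_left hVQ hc₂pos.le
  have hVmin : IsMinOn (action σ p q ⊤) (nehari σ p q ⊤) V := fun V' hV' => by
    have := hle V' hV'
    show action σ p q ⊤ V ≤ action σ p q ⊤ V'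
    linarith
  have hVeq := hle V hVneh
  -- The chain `c₁ * N + c₂ * Q ≤ action σ p q ⊤ V ≤ c₁ * N + c₂ * Q` is tight, so neither Fatou
  -- inequality can be strict.
  have hNeq : N = normSq ⊤ V := le_antisymm
    ((mul_le_mul_iff_of_pos_left hc₁pos).1 (by linarith)) hVN
  have hell : ell σ p q ⊤ = c₁ * N + c₂ * Q := by
    have h1 := (isMinOn_iff_action_le_ell hp hqp hVneh).1 hVmin
    have h2 := ell_le hp hqp hVneh
    linarith
  refine ⟨φ, hφ, fun n => Z (φ n), V, fun n => ⟨hZ _, hZmin _⟩, hVneh, hVmin,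
    hell ▸ hlimell, ?_⟩
  rw [hNeq, normSq_top] at hfN
  have hfin := (tendsto_integral_sq_sub hfL hVL2 hfV hfN).sqrt
  rw [Real.sqrt_zero] at hfin
  have h2 := (ENNReal.continuous_ofReal.tendsto 0).comp hfin
  rw [ENNReal.ofReal_zero] at h2
  refine h2.congr fun n => ?_
  rw [eLpNorm_two_eq (hVL2.sub (hfL n))]
  rfl

end SolitaryLimit

end FPU

/-! ### The main theorem -/

theorem mainTheorem3 (σ p q : ℝ) (hσ : 0 < σ ^ 2) (hp : 2 < p) (hq : 1 < q) (hqp : q < p) :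
    (∃ W ∈ FPU.nehari σ p q ⊤, IsMinOn (FPU.action σ p q ⊤) (FPU.nehari σ p q ⊤) W) ∧
    Tendsto (fun K : ℝ => FPU.ell σ p q (K : EReal)) atTop (𝓝 (FPU.ell σ p q ⊤)) ∧
    ∀ K : ℕ → ℝ, (∀ m, 0 < K m) → ¬ BddAbove (Set.range K) →
      ∃ ν : ℕ → ℕ, StrictMono ν ∧ Tendsto (fun n => K (ν n)) atTop atTop ∧
        ∃ (W : ℕ → ℝ → ℝ) (Winf : ℝ → ℝ),
          (∀ n, W n ∈ FPU.nehari σ p q (K (ν n) : EReal) ∧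
            FPU.IsGroundWave σ p q (K (ν n) : EReal) (W n)) ∧
          (Winf ∈ FPU.nehari σ p q ⊤ ∧ FPU.IsGroundWave σ p q ⊤ Winf) ∧
          (∀ n, (FPU.cell (K (ν n) : EReal)).indicator (W n) ∈ FPU.X p q ⊤) ∧
          Tendsto (fun n => eLpNorm
            (Winf - (FPU.cell (K (ν n) : EReal)).indicator (W n)) 2 volume) atTop (𝓝 0) := by
  refine ⟨?_, ?_, fun K _ hunb => ?_⟩
  · obtain ⟨-, -, -, V, -, hV, hmin, -⟩ := FPU.exists_subseq_tendsto_groundWave hσ hp hq hqp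
      (K := fun n => (n : ℝ) + 1) (fun n => by simp)
      (tendsto_atTop_add_const_right _ 1 tendsto_natCast_atTop_atTop)
    exact ⟨V, hV, hmin⟩
  -- It suffices that every subsequence has a further convergent one. Replacing `K` by `max 1 K`
  -- secures the bound from below and changes nothing eventually.
  · refine tendsto_of_seq_tendsto fun K hK => tendsto_of_subseq_tendsto fun ns hns => ?_
    have hKns : Tendsto (fun n => K (ns n)) atTop atTop := hK.comp hns
    have hmax : Tendsto (fun n => max 1 (K (ns n))) atTop atTop :=
      tendsto_atTop_mono (fun n => le_max_right _ _) hKns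
    obtain ⟨φ, hφ, -, -, -, -, -, hlim, -⟩ := FPU.exists_subseq_tendsto_groundWave hσ hp hq hqp
      (fun n => le_max_left 1 (K (ns n))) hmax
    refine ⟨φ, hlim.congr' ?_⟩
    filter_upwards [(hKns.comp hφ.tendsto_atTop).eventually_ge_atTop 1] with n hn
    have : max 1 (K (ns (φ n))) = K (ns (φ n)) := max_eq_right hn
    simp only [Function.comp, this]
  -- An unbounded sequence exceeds `n + 1` infinitely often; extracting along these bounds gives
  -- both `K ≥ 1` and divergence.
  · have hfreq : ∀ n : ℕ, ∃ᶠ m in atTop, (n : ℝ) + 1 ≤ K m := fun n => by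
      by_contra hcon
      rw [not_frequently] at hcon
      exact hunb (IsBoundedUnder.bddAbove_range
        ⟨(n : ℝ) + 1, hcon.mono fun m hm => (not_le.1 hm).le⟩)
    obtain ⟨ψ, hψ, hKψ⟩ := extraction_forall_of_frequently hfreq
    have hK1 : ∀ n, 1 ≤ K (ψ n) := fun n => by
      have : (0 : ℝ) ≤ n := n.cast_nonneg
      linarith [hKψ n]
    have hKt : Tendsto (fun n => K (ψ n)) atTop atTop :=
      tendsto_atTop_mono hKψ
        (tendsto_atTop_add_const_right _ 1 tendsto_natCast_atTop_atTop)
    obtain ⟨φ, hφ, W, V, hW, hV, hmin, -, hlim⟩ :=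
      FPU.exists_subseq_tendsto_groundWave hσ hp hq hqp hK1 hKt
    have hKE : ∀ n, (1 : EReal) ≤ K (ψ (φ n)) := fun n => by exact_mod_cast hK1 (φ n)
    refine ⟨ψ ∘ φ, hψ.comp hφ, hKt.comp hφ.tendsto_atTop, W, V, fun n => ⟨(hW n).1, ?_⟩,
      ⟨hV, FPU.isGroundWave_of_isMinOn hσ hp hq hqp le_top hV hmin⟩, fun n => ?_, hlim⟩
    · exact FPU.isGroundWave_of_isMinOn hσ hp hq hqp (hKE n) (hW n).1 (hW n).2
    · exact FPU.indicator_cell_mem_X hp hq (hW n).1.1.1
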